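/- **Setting.** Let $f_i:\mathbb R^{n_1}\times\dots\times\mathbb R^{n_N}\to\mathbb R^{n_i}$, $i=1,\dots,N$, be continuously differentiable, and write $x=(x_1,\dots,x_N)$ (systems are ordered from the slowest, $1$, to the fastest, $N$). Define recursively, from $N$ down, the extended total derivatives and extended sensitivities $$D_{x_j}f_i=\nabla_{x_j}f_i+\sum_{k=\max(i,j)+1}^N D_{x_k}f_i\,S_{x_j}^{x_k},\qquad S_{x_j}^{x_i}=-(D_{x_i}f_i)^{-1}D_{x_j}f_i\quad(j<i).$$ Call $x$ *regular* if $D_{x_i}f_i(x)$ is invertible for every $i>1$. The predictive-sensitivity system is $M(x)\dot x=f(x)$, where $M$ is block lower triangular with identity diagonal blocks and blocks $-S_{x_j}^{x_i}(x)$ for $j<i$; equivalently $$\Sigma_i:\quad \dot x_i=f_i(x)+\sum_{j<i}S_{x_j}^{x_i}(x)\,\dot x_j ,\qquad i=1,\dots,N .$$ Assume that its vector field $F=M^{-1}f$ is locally Lipschitz on the set of regular points. A branch of steady-state maps consists of continuous maps $x_i^s(x_1,\dots,x_{i-1})$ on open (possibly empty) domains such that, whenever $(x_1,\dots,x_{i-1})$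 lies in the domain of $x_i^s$, the successive completion $(x_1,\dots,x_{i-1},x_i^s,\dots,x_N^s)$ stays in the domains of the later maps and satisfies $f_i(x_1,\dots,x_{i-1},x_i^s,\dots,x_N^s)=0$. The reduced vector fields are $f_i^r(x_1,\dots,x_i)=f_i(x_1,\dots,x_i,x_{i+1}^s,\dots,x_N^s)$. A steady state is a point $x^s$ with $f_i(x^s)=0$ for all $i$. **Theorem.** 1. *(Tracking.)* Fix a branch of steady-state maps, $p\ge1$ and a time $t_0$. (a) Let $I\ni t_0$ be an interval and let $x_1(t),\dots,x_{p-1}(t)$ be differentiable signals on $I$ with values in the domain of $x_p^s$, such that $D_{x_i}f_i$ is invertible for all $i\ge p$, $i>1$, at the points $(x_1(t),\dots,x_{p-1}(t),x_p^s,\dots,x_N^s)$. Then $x_i(t)=x_i^s(x_1(t),\dots,x_{i-1}(t))$, $i\ge p$, is the unique solution on $I$ of the systems $\Sigma_i$, $i\ge p$, with $x_i(t_0)=x_i^s(x_1(t_0),\dots,x_{i-1}(t_0))$ for $i\ge p$. (b) For the whole system $M(x)\dot x=f(x)$, let $x_0$ be a regular initial state at time $t_0$ with $(x_0)_i=x_i^s((x_0)_1,\dots,(x_0)_{i-1})$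 for all $i\ge p$, whose first $p-1$ components lie in the domain of $x_p^s$. Then there is a solution on an open interval around $t_0$ that satisfies $x_i(t)=x_i^s(x_1(t),\dots,x_{i-1}(t))$ for all $i\ge p$; and on every interval $I\ni t_0$ a solution with $x(t_0)=x_0$ that consists of regular points is the unique solution with this initial state, and it satisfies $x_i(t)=x_i^s(x_1(t),\dots,x_{i-1}(t))$ for all $i\ge p$ on $I$ provided that $(x_1(t),\dots,x_{p-1}(t))$ stays in the domain of $x_p^s$. 2. *(Local stability.)* Let $x^s$ be a regular steady state. There is a branch of steady-state maps through $x^s$ (that is, with $x_i^s$ defined at the first $i-1$ components of $x^s$ and equal there to the $i$-th one, for every $i>1$), and $F$ is differentiable at $x^s$. Its Jacobian $J$ is similar to a block upper-triangular matrix whose $i$-th diagonal block is $\nabla_{x_i}f_i^r(x_1^s,\dots,x_i^s)$, $i=1,\dots,N$ (with $f_N^r=f_N$), for every branch through $x^s$; the $f_i^r$ are differentiable in $x_i$ there. 3. *(Global exponential stability.)* Assume that the $f_i$ are globally Lipschitz and that there are symmetric positive definite matrices $P_i,Q_i$ such that, for all $x$ and all $i$, $$P_i\,D_{x_i}f_i(x)+D_{x_i}f_i(x)^TP_i^T\preceq-Q_i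 .$$ Then there is a unique steady state $x^s$, and it is globally exponentially stable for $M(x)\dot x=f(x)$: from every initial state a solution exists for all $t\ge t_0$, and there are $c,r>0$ such that every solution satisfies $\|x(t)-x^s\|\le c\,e^{-r(t-t_0)}\|x(t_0)-x^s\|$ for $t\ge t_0$ in its domain. -/

import Mathlib

open Set Filter Topology

noncomputable section

namespace PredSens

/-- The joint state `(x_1, …, x_N)`, with `x_i ∈ ℝ^{n_i}`. The systems are numbered from `0`, the
slowest, to `N - 1`, the fastest. Each block carries its Euclidean norm; the norm of the joint state
is the largest block norm, which is equivalent to the Euclidean norm of the joint state. -/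
abbrev State {N : ℕ} (n : Fin N → ℕ) : Type := ∀ i : Fin N, EuclideanSpace ℝ (Fin (n i))

/-- The tuples `(x_1, …, x_{i-1})` of states of the systems slower than system `i`. -/
abbrev Slower {N : ℕ} (n : Fin N → ℕ) (i : Fin N) : Type :=
  ∀ j : {j : Fin N // j < i}, EuclideanSpace ℝ (Fin (n j))

variable {N : ℕ} {n : Fin N → ℕ}

/-- `(x_1, …, x_N) ↦ (x_1, …, x_{i-1})`. -/
def slower (i : Fin N) (x : State n) : Slower n i := fun j => x j

/-- The partial derivative `∇_{x_j} g (x)` of a map `g` of the joint state. -/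
def partialD {G : Type*} [NormedAddCommGroup G] [NormedSpace ℝ G]
    (g : State n → G) (j : Fin N) (x : State n) : EuclideanSpace ℝ (Fin (n j)) →L[ℝ] G :=
  fderiv ℝ (fun z => g (Function.update x j z)) (x j)

/-! ### Extended total derivatives and sensitivities -/

/-- The extended total derivative `D_{x_j} f_i (x)`, defined by recursion from the fastest system
down. It is `∇_{x_j} f_i + ∑_{k > max(i,j)} D_{x_k} f_i S_{x_j}^{x_k}` with
`S_{x_j}^{x_k} = -(D_{x_k} f_k)⁻¹ D_{x_j} f_k`; see `totalD_eq`. The inverse is meaningful at the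
points where `D_{x_k} f_k` is invertible (and is `0` by convention elsewhere). -/
def totalD (f : ∀ i : Fin N, State n → EuclideanSpace ℝ (Fin (n i))) (x : State n) :
    (i j : Fin N) → (EuclideanSpace ℝ (Fin (n j)) →L[ℝ] EuclideanSpace ℝ (Fin (n i)))
  | i, j => partialD (f i) j x + ∑ k : {k : Fin N // max i j < k},
      (totalD f x i k.1).comp (-((totalD f x k.1 k.1).inverse.comp (totalD f x k.1 j)))
termination_by i j => N - (max i j).val
decreasing_by
  all_goals
    have h1 := k.2
    have _h2 := k.1.isLt
    simp only [max_lt_iff, Fin.lt_def, Fin.coe_max] at *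
    omega

/-- The extended sensitivity `S_{x_j}^{x_i} (x) = -(D_{x_i} f_i)⁻¹ D_{x_j} f_i`, used for `j < i`. -/
def sens (f : ∀ i : Fin N, State n → EuclideanSpace ℝ (Fin (n i))) (x : State n) (i j : Fin N) :
    EuclideanSpace ℝ (Fin (n j)) →L[ℝ] EuclideanSpace ℝ (Fin (n i)) :=
  -((totalD f x i i).inverse.comp (totalD f x i j))

theorem totalD_eq (f : ∀ i : Fin N, State n → EuclideanSpace ℝ (Fin (n i))) (x : State n)
    (i j : Fin N) :
    totalD f x i j = partialD (f i) j x +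
      ∑ k : {k : Fin N // max i j < k}, (totalD f x i k.1).comp (sens f x k.1 j) := by
  rw [totalD]; rfl

/-- The points at which the conditioning matrix is well defined: `D_{x_i} f_i` is invertible for
every system `i` but the slowest one. -/
def Regular (f : ∀ i : Fin N, State n → EuclideanSpace ℝ (Fin (n i))) (x : State n) : Prop :=
  ∀ i : Fin N, 0 < i.val → (totalD f x i i).IsInvertible

/-! ### The predictive-sensitivity system -/

/-- The conditioning matrix `M(x)`: identity blocks on the diagonal and `-S_{x_j}^{x_i}(x)` in the
block `(i, j)` for `j < i`. -/
def condM (f : ∀ i : Fin N, State n → EuclideanSpace ℝ (Fin (n i))) (x : State n) :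
    State n →L[ℝ] State n :=
  ContinuousLinearMap.pi fun i =>
    (ContinuousLinearMap.proj i : State n →L[ℝ] EuclideanSpace ℝ (Fin (n i))) -
      ∑ j : {j : Fin N // j < i}, (sens f x i j.1).comp
        (ContinuousLinearMap.proj j.1 : State n →L[ℝ] EuclideanSpace ℝ (Fin (n j.1)))

theorem condM_apply (f : ∀ i : Fin N, State n → EuclideanSpace ℝ (Fin (n i))) (x v : State n)
    (i : Fin N) :
    condM f x v i = v i - ∑ j : {j : Fin N // j < i}, sens f x i j.1 (v j.1) := by
  simp [condM]

/-- The vector field `F(x) = M(x)⁻¹ f(x)` of the predictive-sensitivity system, that is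
`F_i = f_i + ∑_{j < i} S_{x_j}^{x_i} F_j`; see `condM_eq_iff`. -/
def predField (f : ∀ i : Fin N, State n → EuclideanSpace ℝ (Fin (n i))) (x : State n) :
    (i : Fin N) → EuclideanSpace ℝ (Fin (n i))
  | i => f i x + ∑ j : {j : Fin N // j < i}, sens f x i j.1 (predField f x j.1)
termination_by i => i.val
decreasing_by exact j.2

theorem predField_apply (f : ∀ i : Fin N, State n → EuclideanSpace ℝ (Fin (n i))) (x : State n)
    (i : Fin N) :
    predField f x i = f i x +
      ∑ j : {j : Fin N // j < i}, sens f x i j.1 (predField f x j.1) := by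
  conv_lhs => unfold predField

theorem condM_eq_iff (f : ∀ i : Fin N, State n → EuclideanSpace ℝ (Fin (n i))) (x v : State n) :
    condM f x v = (fun i => f i x) ↔ v = predField f x := by
  constructor
  · intro h
    have key : ∀ m : ℕ, ∀ i : Fin N, i.val = m → v i = predField f x i := by
      intro m
      induction m using Nat.strong_induction_on with
      | _ m ih =>
        intro i hi
        have hi' := congrFun h i
        rw [condM_apply, sub_eq_iff_eq_add] at hi'
        rw [predField_apply, hi']
        exact congrArg _ (Finset.sum_congr rfl fun j _ =>
          congrArg (sens f x i j.1) (ih j.1.val (hi ▸ j.2) j.1 rfl))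
    funext i
    exact key i.val i rfl
  · rintro rfl
    funext i
    rw [condM_apply, predField_apply f x i, add_sub_cancel_right]

/-- `x` is a solution on `I` of `M(x) ẋ = f(x)`, the predictive-sensitivity system. (At an end point
of `I` that belongs to `I` the derivative is one-sided.) -/
def IsSolution (f : ∀ i : Fin N, State n → EuclideanSpace ℝ (Fin (n i))) (I : Set ℝ)
    (x : ℝ → State n) : Prop :=
  ∃ x' : ℝ → State n, ∀ t ∈ I, HasDerivWithinAt x (x' t) I t ∧
    condM f (x t) (x' t) = fun i => f i (x t)

/-- The curve `x` obeys on `I` the dynamics `ẋ_i = f_i(x) + ∑_{j < i} S_{x_j}^{x_i}(x) ẋ_j` of the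
systems `i ≥ p`; the slower components `x_j`, `j < p`, are arbitrary differentiable signals. -/
def IsSolutionFrom (f : ∀ i : Fin N, State n → EuclideanSpace ℝ (Fin (n i))) (p : Fin N)
    (I : Set ℝ) (x : ℝ → State n) : Prop :=
  ∃ x' : ℝ → State n, ∀ t ∈ I, HasDerivWithinAt x (x' t) I t ∧
    ∀ i, p ≤ i → x' t i = f i (x t) + ∑ j : {j : Fin N // j < i}, sens f (x t) i j.1 (x' t j.1)

/-! ### Steady-state maps and reduced vector fields -/

/-- For maps `ξ_k(x_1, …, x_{k-1})`, the point `(x_1, …, x_m, ξ_{m+1}, …, ξ_N)` that has the same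
first `m` components as `x` and in which every further component is given by the map `ξ_k` at the
components before it. -/
def fill (ξ : ∀ k : Fin N, Slower n k → EuclideanSpace ℝ (Fin (n k))) (m : ℕ) (x : State n) :
    (k : Fin N) → EuclideanSpace ℝ (Fin (n k))
  | k => if k.val < m then x k else ξ k fun j => fill ξ m x j.1
termination_by k => k.val
decreasing_by exact j.2

/-- A (local) branch of the steady-state maps `x_i^s(x_1, …, x_{i-1})`: each is continuous on an open
set `dom i` (possibly empty), the completion `(x_1, …, x_{i-1}, x_i^s, …, x_N^s)` of a tuple in
`dom i` stays in the domains of the further maps, and there `f_i` vanishes, that is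
`f_i^r(x_1, …, x_{i-1}, x_i^s) = 0`. -/
structure SteadyMaps (f : ∀ i : Fin N, State n → EuclideanSpace ℝ (Fin (n i))) where
  dom : ∀ i : Fin N, Set (Slower n i)
  map : ∀ i : Fin N, Slower n i → EuclideanSpace ℝ (Fin (n i))
  isOpen_dom : ∀ i, IsOpen (dom i)
  continuousOn_map : ∀ i, ContinuousOn (map i) (dom i)
  slower_fill_mem : ∀ (i : Fin N) (x : State n), slower i x ∈ dom i →
    ∀ k, i ≤ k → slower k (fill map i.val x) ∈ dom k
  steady : ∀ (i : Fin N) (x : State n), slower i x ∈ dom i → f i (fill map i.val x) = 0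

/-- In the state `x`, every system `i ≥ p` is at its steady state: `x_i = x_i^s(x_1, …, x_{i-1})`. -/
def SteadyMaps.Tracks {f : ∀ i : Fin N, State n → EuclideanSpace ℝ (Fin (n i))} (B : SteadyMaps f)
    (p : Fin N) (x : State n) : Prop :=
  ∀ i, p ≤ i → x i = B.map i (slower i x)

/-- The branch passes through the steady state `xs`: for every system `i` but the slowest one,
`x_i^s` is defined at `(x_1, …, x_{i-1})` and takes the value `x_i` there. -/
def SteadyMaps.Through {f : ∀ i : Fin N, State n → EuclideanSpace ℝ (Fin (n i))} (B : SteadyMaps f)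
    (xs : State n) : Prop :=
  ∀ i : Fin N, 0 < i.val → slower i xs ∈ B.dom i ∧ xs i = B.map i (slower i xs)

/-- The reduced vector field `f_i^r(x_1, …, x_i) = f_i(x_1, …, x_i, x_{i+1}^s, …, x_N^s)`, written as
a function of the joint state that does not depend on `x_{i+1}, …, x_N`. -/
def reduced (f : ∀ i : Fin N, State n → EuclideanSpace ℝ (Fin (n i))) (B : SteadyMaps f)
    (i : Fin N) (x : State n) : EuclideanSpace ℝ (Fin (n i)) :=
  f i (fill B.map (i.val + 1) x)

/-! ### Steady states, block entries and exponential stability -/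

/-- A steady state: `f_i(x_1^s, …, x_N^s) = 0` for all `i`. -/
def IsSteady (f : ∀ i : Fin N, State n → EuclideanSpace ℝ (Fin (n i))) (x : State n) : Prop :=
  ∀ i, f i x = 0

/-- The block `(i, j)` of a linear map of the joint state space. -/
def block (K : State n →L[ℝ] State n) (i j : Fin N) :
    EuclideanSpace ℝ (Fin (n j)) →L[ℝ] EuclideanSpace ℝ (Fin (n i)) :=
  ((ContinuousLinearMap.proj i).comp K).comp
    (ContinuousLinearMap.single ℝ (fun i : Fin N => EuclideanSpace ℝ (Fin (n i))) j)

/-- The contraction inequality `P_i D_{x_i} f_i + (P_i D_{x_i} f_i)ᵀ ⪯ -Q_i` at the point `x`. -/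
def ContractionLMI (f : ∀ i : Fin N, State n → EuclideanSpace ℝ (Fin (n i))) (i : Fin N)
    (P Q : Matrix (Fin (n i)) (Fin (n i)) ℝ) (x : State n) : Prop :=
  let A : Matrix (Fin (n i)) (Fin (n i)) ℝ :=
    (Matrix.toEuclideanCLM (n := Fin (n i)) (𝕜 := ℝ)).symm (totalD f x i i)
  (-Q - (P * A + A.transpose * P.transpose)).PosSemidef

/-- Global exponential stability of `xs` for the predictive-sensitivity system: from every initial
state there is a solution for all future times, and all solutions converge to `xs` exponentially,
with a uniform rate and a uniform overshoot constant. -/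
def IsGloballyExpStable (f : ∀ i : Fin N, State n → EuclideanSpace ℝ (Fin (n i)))
    (xs : State n) : Prop :=
  (∀ (t₀ : ℝ) (x₀ : State n), ∃ x : ℝ → State n, x t₀ = x₀ ∧ IsSolution f (Ici t₀) x) ∧
  ∃ c > 0, ∃ r > 0, ∀ (t₀ : ℝ) (I : Set ℝ) (x : ℝ → State n),
    I.OrdConnected → t₀ ∈ I → I ⊆ Ici t₀ → IsSolution f I x →
      ∀ t ∈ I, ‖x t - xs‖ ≤ c * Real.exp (-r * (t - t₀)) * ‖x t₀ - xs‖

end PredSens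

end

open PredSens

noncomputable section

namespace PredSens

variable {N : ℕ} {n : Fin N → ℕ} {f : ∀ i : Fin N, State n → EuclideanSpace ℝ (Fin (n i))}

/-! ### The block factorisation of the derivative of `f` -/

/-! Let U(x) be the block upper triangular matrix with blocks D_{x_k} f_i, i ≤ k. The recursion for
the extended derivatives amounts to a factorisation ∇f = U M (`fderiv_apply_eq_sum_totalD`): for i ≤
j, block (i, j) is the recursion itself; for j < i it also uses D_{x_i} f_i S_{x_j}^{x_i} = -D_{x_j}
f_i. Hence along M(x)ẋ = f(x) the right-hand side satisfies d/dt f(x) = ∇f ẋ = U(x) f(x). All three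
parts rest on this.

Tracking. The rows i ≥ p of this equation involve only f_i with i ≥ p, so by Grönwall these
components stay zero once they all vanish. The map (x_1, …, x_m, f_{m+1}, …, f_N), `tailMap`, is a
local diffeomorphism where D_{x_k} f_k is invertible for k > m, and completion by the steady-state
maps is a local inverse of it over the points (x_1, …, x_m, 0, …, 0). Vanishing right-hand sides
therefore keep a curve on the branch, locally in time, and a clopen argument makes this global.

Jacobian. Since f(x^s) = 0, the derivative of M⁻¹f at x^s is M⁻¹∇f = M⁻¹ U M, similar to U. Implicit
differentiation of the completion identifies the diagonal blocks D_{x_i} f_i with ∇_{x_i} f_i^r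
(`hasFDerivAt_reduced`).

Global stability. A weighted sum ∑ K^i u_iᵀ P_i u_i with K large decays along u̇ = U u, because the
contraction inequality controls the diagonal blocks of U and the others are bounded
(`exists_weight`); so f decays exponentially. By downward induction on m every `tailMap f m` has a
global Lipschitz inverse (`HasLipschitzInverse.pred`): each new block is found by solving an
equation for a strongly monotone map whose derivative is D_{x_i} f_i. For m = 0 this yields the
unique zero x^s and makes ‖x - x^s‖ comparable to ‖f(x)‖, which transfers the decay to x. For m > 0
it bounds the blocks of U and the columns of M⁻¹, so F has linear growth and solutions exist for all
future times. -/

theorem pi_single_id_apply (i : Fin N) (v : EuclideanSpace ℝ (Fin (n i))) :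
    (ContinuousLinearMap.pi (Pi.single i (ContinuousLinearMap.id ℝ
      (EuclideanSpace ℝ (Fin (n i)))))) v = (Pi.single i v : State n) := by
  funext k
  by_cases hk : k = i
  · subst hk; simp
  · simp [hk]

theorem partialD_eq_comp_single {G : Type*} [NormedAddCommGroup G] [NormedSpace ℝ G]
    {g : State n → G} {x : State n} (hg : DifferentiableAt ℝ g x) (j : Fin N) :
    partialD g j x = (fderiv ℝ g x).comp
      (ContinuousLinearMap.single ℝ (fun i : Fin N => EuclideanSpace ℝ (Fin (n i))) j) := by
  have h1 : HasFDerivAt g (fderiv ℝ g x) (Function.update x j (x j)) := by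
    rw [Function.update_eq_self]; exact hg.hasFDerivAt
  refine (h1.comp (x j) (hasFDerivAt_update x (x j))).fderiv.trans ?_
  ext v : 1
  exact congrArg (fderiv ℝ g x) (pi_single_id_apply j v)

theorem fderiv_apply_eq_sum_partialD {G : Type*} [NormedAddCommGroup G] [NormedSpace ℝ G]
    {g : State n → G} {x : State n} (hg : DifferentiableAt ℝ g x) (v : State n) :
    fderiv ℝ g x v = ∑ j, partialD g j x (v j) := by
  have hv : v = ∑ j, ContinuousLinearMap.single ℝ
      (fun i : Fin N => EuclideanSpace ℝ (Fin (n i))) j (v j) := by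
    simp only [ContinuousLinearMap.single_apply]
    exact (Finset.univ_sum_single v).symm
  conv_lhs => rw [hv, map_sum]
  exact Finset.sum_congr rfl fun j _ => by rw [partialD_eq_comp_single hg j]; rfl

theorem sum_subtype_eq_sum_ite {M : Type*} [AddCommMonoid M] (p : Fin N → Prop)
    [DecidablePred p] (g : Fin N → M) :
    ∑ k : {k : Fin N // p k}, g k = ∑ k, if p k then g k else 0 := by
  rw [← Finset.sum_filter]
  exact (Finset.sum_subtype _ (by simp) g).symm

theorem partialD_apply_eq (x : State n) (i j : Fin N) (w : EuclideanSpace ℝ (Fin (n j))) :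
    partialD (f i) j x w = totalD f x i j w -
      ∑ k, if max i j < k then totalD f x i k (sens f x k j w) else 0 := by
  rw [totalD_eq, ← sum_subtype_eq_sum_ite (fun k => max i j < k)
    (fun k => totalD f x i k (sens f x k j w))]
  simp

theorem condM_apply_ite (x v : State n) (k : Fin N) :
    condM f x v k = v k - ∑ j, if j < k then sens f x k j (v j) else 0 := by
  rw [condM_apply, ← sum_subtype_eq_sum_ite (fun j => j < k) (fun j => sens f x k j (v j))]

theorem totalD_comp_sens {x : State n} {i : Fin N} (h : (totalD f x i i).IsInvertible) (j : Fin N)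
    (w : EuclideanSpace ℝ (Fin (n j))) : totalD f x i i (sens f x i j w) = -totalD f x i j w := by
  simp [sens, h.self_apply_inverse]

/-- Row `i` of the factorisation `∇f = U M`, with `U` the block upper triangular matrix of the
`D_{x_k} f_i`, `k ≥ i`. -/
theorem fderiv_apply_eq_sum_totalD {x : State n} {i : Fin N} (hd : DifferentiableAt ℝ (f i) x)
    (hi : 0 < i.val → (totalD f x i i).IsInvertible) (v : State n) :
    fderiv ℝ (f i) x v = ∑ k ∈ Finset.Ici i, totalD f x i k (condM f x v k) := by
  -- Both sides are compared column by column, that is by the coefficient of each v_j.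
  have hR : ∑ k ∈ Finset.Ici i, totalD f x i k (condM f x v k) =
      ∑ j, ((if i ≤ j then totalD f x i j (v j) else 0) -
        ∑ k, if i ≤ k ∧ j < k then totalD f x i k (sens f x k j (v j)) else 0) := by
    rw [Finset.sum_sub_distrib, Finset.sum_comm, ← Finset.sum_sub_distrib]
    have : Finset.Ici i = Finset.univ.filter fun k => i ≤ k := by ext; simp
    rw [this, Finset.sum_filter]
    refine Finset.sum_congr rfl fun k _ => ?_
    split_ifs with hk
    · rw [condM_apply_ite, map_sub, map_sum]
      congr 1
      refine Finset.sum_congr rfl fun j _ => ?_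
      by_cases hj : j < k <;> simp [hj, hk]
    · simp [hk]
  rw [hR, fderiv_apply_eq_sum_partialD hd]
  refine Finset.sum_congr rfl fun j _ => ?_
  rw [partialD_apply_eq]
  rcases le_or_gt i j with hij | hij
  -- For i ≤ j the recursion sums over k > j, where i ≤ k is automatic.
  · simp only [hij, if_true, max_eq_right]
    congr 1
    refine Finset.sum_congr rfl fun k _ => if_congr ⟨fun h => ⟨hij.trans h.le, h⟩, And.right⟩ rfl rfl
  -- For j < i the recursion sums over k > i only. The extra summand k = i equals D_{x_i} f_i
  -- S_{x_j}^{x_i} = -D_{x_j} f_i and supplies the missing term; it occurs only for i > 0, so the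
  -- slowest system needs no invertibility.
  · have h0 : 0 < i.val := lt_of_le_of_lt (Nat.zero_le _) hij
    simp only [hij.not_ge, if_false, max_eq_left hij.le, zero_sub]
    rw [← neg_eq_iff_eq_neg, neg_sub, sub_eq_iff_eq_add]
    have : ∀ k, (if i ≤ k ∧ j < k then totalD f x i k (sens f x k j (v j)) else 0) =
        (if i < k then totalD f x i k (sens f x k j (v j)) else 0) +
          if k = i then totalD f x i k (sens f x k j (v j)) else 0 := by
      intro k
      rcases lt_trichotomy k i with h | h | h
      · simp [h.not_ge, h.not_gt, h.ne]
      · subst h; simp [hij]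
      · simp [h, h.le, hij.trans h, h.ne']
    simp only [this, Finset.sum_add_distrib, Finset.sum_ite_eq', Finset.mem_univ, if_true,
      totalD_comp_sens (hi h0)]
    abel

/-- The systems `k ≥ m` have invertible extended total derivatives at `x`. -/
def TailRegular (f : ∀ i : Fin N, State n → EuclideanSpace ℝ (Fin (n i))) (m : ℕ)
    (x : State n) : Prop :=
  ∀ k : Fin N, m ≤ k.val → (totalD f x k k).IsInvertible

theorem Regular.tailRegular {x : State n} (h : Regular f x) {m : ℕ} (hm : 0 < m) :
    TailRegular f m x := fun k hk => h k (hm.trans_le hk)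

theorem regular_iff_tailRegular {x : State n} : Regular f x ↔ TailRegular f 1 x := Iff.rfl

theorem TailRegular.mono {x : State n} {m m' : ℕ} (h : TailRegular f m x) (hm : m ≤ m') :
    TailRegular f m' x := fun k hk => h k (hm.trans hk)

/-- Back substitution from the fastest system: the rows k ≥ m of U (M v) = 0 form a block upper
triangular system with invertible diagonal blocks. -/
theorem condM_eq_zero_of_fderiv_eq_zero {x v : State n} {m : ℕ}
    (hd : ∀ i, DifferentiableAt ℝ (f i) x) (hx : TailRegular f m x)
    (hv : ∀ k : Fin N, m ≤ k.val → fderiv ℝ (f k) x v = 0) :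
    ∀ k : Fin N, m ≤ k.val → condM f x v k = 0 := by
  have key : ∀ d : ℕ, ∀ k : Fin N, N - k.val = d → m ≤ k.val → condM f x v k = 0 := by
    intro d
    induction d using Nat.strong_induction_on with
    | _ d ih =>
      intro k hd' hk
      have h1 := fderiv_apply_eq_sum_totalD (hd k) (fun _ => hx k hk) v
      rw [hv k hk, Finset.sum_eq_single_of_mem k (by simp)] at h1
      · exact (hx k hk).injective (by rw [← h1, map_zero])
      · intro l hl hlk
        have hl : k < l := lt_of_le_of_ne (Finset.mem_Ici.1 hl) (Ne.symm hlk)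
        have := l.isLt
        rw [ih (N - l.val) (by omega) l rfl (hk.trans hl.le), map_zero]
  exact fun k => key _ k rfl

/-- Forward substitution: M is block lower triangular with identity diagonal. -/
theorem eq_zero_of_condM_eq_zero {x v : State n} {m : ℕ} (h0 : ∀ k : Fin N, k.val < m → v k = 0)
    (h1 : ∀ k : Fin N, m ≤ k.val → condM f x v k = 0) : v = 0 := by
  have key : ∀ d : ℕ, ∀ k : Fin N, k.val = d → v k = 0 := by
    intro d
    induction d using Nat.strong_induction_on with
    | _ d ih =>
      intro k hk
      rcases lt_or_ge k.val m with h | h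
      · exact h0 k h
      · have h2 := h1 k h
        rw [condM_apply, sub_eq_zero] at h2
        rw [h2]
        exact Finset.sum_eq_zero fun j _ => by rw [ih j.1.val (hk ▸ j.2) j.1 rfl, map_zero]
  funext k
  exact key _ k rfl

theorem condM_injective (x : State n) : Function.Injective (condM f x) := by
  refine (injective_iff_map_eq_zero _).2 fun v hv => ?_
  exact eq_zero_of_condM_eq_zero (f := f) (x := x) (m := 0) (fun k hk => absurd hk (by omega))
    fun k _ => by rw [hv]; rfl

/-- If `∇f_k v = 0` for all `k > i` and `v` vanishes in the blocks before `i`, then `M v` is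
concentrated in block `i`. -/
theorem condM_eq_single {x v : State n} {i : Fin N}
    (hd : ∀ i, DifferentiableAt ℝ (f i) x) (hx : TailRegular f (i.val + 1) x)
    (h0 : ∀ k : Fin N, k < i → v k = 0) (h1 : ∀ k : Fin N, i < k → fderiv ℝ (f k) x v = 0) :
    condM f x v = Pi.single i (v i) := by
  funext k
  rcases lt_trichotomy k i with h | h | h
  · rw [Pi.single_eq_of_ne h.ne, condM_apply, h0 k h, Finset.sum_eq_zero, sub_zero]
    exact fun j _ => by rw [h0 j.1 (lt_trans j.2 h), map_zero]
  · subst h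
    rw [Pi.single_eq_same, condM_apply, Finset.sum_eq_zero, sub_zero]
    exact fun j _ => by rw [h0 j.1 j.2, map_zero]
  · rw [Pi.single_eq_of_ne h.ne']
    exact condM_eq_zero_of_fderiv_eq_zero hd hx (fun k hk => h1 k hk) k h

/-- If `M v` is concentrated in block `i`, then `∇f_l v = D_{x_i} f_l v_i` for `l ≤ i`. -/
theorem fderiv_apply_eq_totalD {x v : State n} {i l : Fin N} {w : EuclideanSpace ℝ (Fin (n i))}
    (hd : DifferentiableAt ℝ (f l) x) (hv : condM f x v = Pi.single i w) (hl : l ≤ i)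
    (hlx : 0 < l.val → (totalD f x l l).IsInvertible) :
    fderiv ℝ (f l) x v = totalD f x l i w := by
  rw [fderiv_apply_eq_sum_totalD hd hlx, hv,
    Finset.sum_eq_single_of_mem i (by simpa using hl), Pi.single_eq_same]
  intro k _ hk
  rw [Pi.single_eq_of_ne hk, map_zero]

/-! ### The map `(x_1, …, x_m, f_{m+1}(x), …, f_N(x))` -/

/-- The map `x ↦ (x_1, …, x_m, f_{m+1}(x), …, f_N(x))`. -/
def tailMap (f : ∀ i : Fin N, State n → EuclideanSpace ℝ (Fin (n i))) (m : ℕ) (x : State n) :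
    State n :=
  fun i => if i.val < m then x i else f i x

/-- The derivative of `tailMap f m`. -/
def tailD (f : ∀ i : Fin N, State n → EuclideanSpace ℝ (Fin (n i))) (m : ℕ) (x : State n) :
    State n →L[ℝ] State n :=
  ContinuousLinearMap.pi fun i =>
    if i.val < m then ContinuousLinearMap.proj i else fderiv ℝ (f i) x

theorem tailMap_of_lt {m : ℕ} {i : Fin N} (h : i.val < m) (x : State n) :
    tailMap f m x i = x i := if_pos h

theorem tailMap_of_le {m : ℕ} {i : Fin N} (h : m ≤ i.val) (x : State n) :
    tailMap f m x i = f i x := if_neg h.not_gt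

theorem tailD_of_lt {m : ℕ} {i : Fin N} (h : i.val < m) (x v : State n) :
    tailD f m x v i = v i := by simp [tailD, h]

theorem tailD_of_le {m : ℕ} {i : Fin N} (h : m ≤ i.val) (x v : State n) :
    tailD f m x v i = fderiv ℝ (f i) x v := by simp [tailD, h.not_gt]

theorem hasStrictFDerivAt_tailMap (hf : ∀ i, ContDiff ℝ 1 (f i)) (m : ℕ) (x : State n) :
    HasStrictFDerivAt (tailMap f m) (tailD f m x) x := by
  refine hasStrictFDerivAt_pi.2 fun i => ?_
  by_cases h : i.val < m
  · simp only [tailMap, h, if_true]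
    exact hasStrictFDerivAt_apply i x
  · simp only [tailMap, h, if_false]
    exact (hf i).contDiffAt.hasStrictFDerivAt one_ne_zero

/-- A kernel vector has zero head and is annihilated by ∇f_k, k ≥ m. Back substitution gives (M v)_k
= 0 for these k, and forward substitution gives v = 0. The inverse function theorem thus applies to
`tailMap f m`. -/
theorem tailD_injective (hf : ∀ i, ContDiff ℝ 1 (f i)) {m : ℕ} {x : State n}
    (hx : TailRegular f m x) : Function.Injective (tailD f m x) := by
  refine (injective_iff_map_eq_zero _).2 fun v hv => ?_
  refine eq_zero_of_condM_eq_zero (f := f) (x := x) (m := m)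
    (fun k hk => by rw [← tailD_of_lt (f := f) hk x v, hv]; rfl)
    (condM_eq_zero_of_fderiv_eq_zero (fun i => (hf i).differentiable one_ne_zero x) hx
      fun k hk => by rw [← tailD_of_le hk x v, hv]; rfl)

/-- An injective endomorphism of a finite-dimensional space, as an equivalence. -/
def equivOfInjective {E : Type*} [NormedAddCommGroup E] [NormedSpace ℝ E] [FiniteDimensional ℝ E]
    (A : E →L[ℝ] E) (h : Function.Injective A) : E ≃L[ℝ] E :=
  (LinearEquiv.ofInjectiveEndo (A : E →ₗ[ℝ] E) h).toContinuousLinearEquiv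

theorem coe_equivOfInjective {E : Type*} [NormedAddCommGroup E] [NormedSpace ℝ E]
    [FiniteDimensional ℝ E] (A : E →L[ℝ] E) (h : Function.Injective A) :
    (equivOfInjective A h : E →L[ℝ] E) = A := by
  ext v; rfl

theorem isInvertible_of_injective {E : Type*} [NormedAddCommGroup E] [NormedSpace ℝ E]
    [FiniteDimensional ℝ E] {A : E →L[ℝ] E} (h : Function.Injective A) : A.IsInvertible :=
  ⟨equivOfInjective A h, coe_equivOfInjective A h⟩

theorem hasStrictFDerivAt_tailMap_equiv (hf : ∀ i, ContDiff ℝ 1 (f i)) {m : ℕ} {x : State n}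
    (hx : TailRegular f m x) : HasStrictFDerivAt (tailMap f m)
      (equivOfInjective _ (tailD_injective hf hx) : State n →L[ℝ] State n) x := by
  rw [coe_equivOfInjective]
  exact hasStrictFDerivAt_tailMap hf m x

/-! ### Continuity of the extended derivatives -/

theorem continuous_partialD {G : Type*} [NormedAddCommGroup G] [NormedSpace ℝ G]
    {g : State n → G} (hg : ContDiff ℝ 1 g) (j : Fin N) : Continuous (partialD g j) := by
  have : partialD g j = fun x => (fderiv ℝ g x).comp
      (ContinuousLinearMap.single ℝ (fun i : Fin N => EuclideanSpace ℝ (Fin (n i))) j) :=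
    funext fun x => partialD_eq_comp_single (hg.differentiable one_ne_zero x) j
  rw [this]
  exact (hg.continuous_fderiv one_ne_zero).clm_comp continuous_const

/-- Induction on N - max(i, j), following the recursion: it inverts only D_{x_k} f_k with k > max(i,
j), and inversion is continuous at invertible operators. -/
theorem continuousAt_totalD (hf : ∀ i, ContDiff ℝ 1 (f i)) {x : State n} (i j : Fin N)
    (hx : TailRegular f ((max i j).val + 1) x) : ContinuousAt (fun y => totalD f y i j) x := by
  have key : ∀ d : ℕ, ∀ i j : Fin N, N - (max i j).val = d → TailRegular f ((max i j).val + 1) x →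
      ContinuousAt (fun y => totalD f y i j) x := by
    intro d
    induction d using Nat.strong_induction_on with
    | _ d ih =>
      intro i j hd hx
      have hrw : (fun y => totalD f y i j) = fun y => partialD (f i) j y +
          ∑ k : {k : Fin N // max i j < k},
            (totalD f y i k.1).comp (-((totalD f y k.1 k.1).inverse.comp (totalD f y k.1 j))) :=
        funext fun y => totalD_eq f y i j
      rw [hrw]
      refine (continuous_partialD (hf i) j).continuousAt.add
        (tendsto_finsetSum _ fun k _ => ?_)
      obtain ⟨k, hk⟩ := k
      have hik : i < k := lt_of_le_of_lt (le_max_left _ _) hk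
      have hjk : j < k := lt_of_le_of_lt (le_max_right _ _) hk
      have hkN := k.isLt
      have hk' : (max i j).val < k.val := hk
      have h1 : ContinuousAt (fun y => totalD f y i k) x :=
        ih (N - (max i k).val) (by rw [max_eq_right hik.le]; omega) i k rfl
          (by rw [max_eq_right hik.le]; exact hx.mono (by omega))
      have h2 : ContinuousAt (fun y => totalD f y k k) x :=
        ih (N - (max k k).val) (by rw [max_self]; omega) k k rfl
          (by rw [max_self]; exact hx.mono (by omega))
      have h3 : ContinuousAt (fun y => totalD f y k j) x :=
        ih (N - (max k j).val) (by rw [max_eq_left hjk.le]; omega) k j rfl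
          (by rw [max_eq_left hjk.le]; exact hx.mono (by omega))
      have h4 : ContinuousAt (fun y => (totalD f y k k).inverse) x :=
        ContinuousAt.comp (g := ContinuousLinearMap.inverse)
          ((hx k hk).contDiffAt_map_inverse (n := 0)).continuousAt h2
      exact h1.clm_comp (h4.clm_comp h3).neg
  exact key _ i j rfl hx

theorem continuousAt_sens (hf : ∀ i, ContDiff ℝ 1 (f i)) {x : State n} {i j : Fin N} (hij : j < i)
    (hx : TailRegular f i.val x) : ContinuousAt (fun y => sens f y i j) x := by
  have h2 : ContinuousAt (fun y => totalD f y i i) x :=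
    continuousAt_totalD hf i i (by rw [max_self]; exact hx.mono (by omega))
  have h3 : ContinuousAt (fun y => totalD f y i j) x :=
    continuousAt_totalD hf i j (by rw [max_eq_left hij.le]; exact hx.mono (by omega))
  have h4 : ContinuousAt (fun y => (totalD f y i i).inverse) x :=
    ContinuousAt.comp (g := ContinuousLinearMap.inverse)
      ((hx i le_rfl).contDiffAt_map_inverse (n := 0)).continuousAt h2
  exact (h4.clm_comp h3).neg

theorem eventually_isInvertible {E F X : Type*} [NormedAddCommGroup E] [NormedSpace ℝ E]
    [CompleteSpace E] [NormedAddCommGroup F] [NormedSpace ℝ F] [TopologicalSpace X]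
    {A : X → E →L[ℝ] F} {x : X} (hA : ContinuousAt A x) (hx : (A x).IsInvertible) :
    ∀ᶠ y in 𝓝 x, (A y).IsInvertible := by
  obtain ⟨e, he⟩ := hx
  have h := ContinuousLinearEquiv.nhds e
  rw [he] at h
  exact hA h

theorem eventually_tailRegular (hf : ∀ i, ContDiff ℝ 1 (f i)) {m : ℕ} {x : State n}
    (hx : TailRegular f m x) : ∀ᶠ y in 𝓝 x, TailRegular f m y := by
  refine eventually_all.2 fun k => ?_
  by_cases hk : m ≤ k.val
  · filter_upwards [eventually_isInvertible (continuousAt_totalD hf k k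
      (by rw [max_self]; exact hx.mono (by omega))) (hx k hk)] with y hy _ using hy
  · exact Eventually.of_forall fun y h => absurd h hk

theorem isOpen_setOf_regular (hf : ∀ i, ContDiff ℝ 1 (f i)) : IsOpen {x | Regular f x} :=
  isOpen_iff_mem_nhds.2 fun _ hx => eventually_tailRegular hf (regular_iff_tailRegular.1 hx)

/-- The block upper triangular matrix with the blocks `D_{x_k} f_i`, `m ≤ i ≤ k`. -/
def upper (f : ∀ i : Fin N, State n → EuclideanSpace ℝ (Fin (n i))) (m : ℕ) (x : State n) :
    State n →L[ℝ] State n :=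
  ContinuousLinearMap.pi fun i => ∑ k, if m ≤ i.val ∧ i ≤ k then
    (totalD f x i k).comp (ContinuousLinearMap.proj k : State n →L[ℝ] EuclideanSpace ℝ (Fin (n k)))
    else 0

theorem upper_apply {m : ℕ} {i : Fin N} (hi : m ≤ i.val) (x v : State n) :
    upper f m x v i = ∑ k ∈ Finset.Ici i, totalD f x i k (v k) := by
  have : Finset.Ici i = Finset.univ.filter fun k => i ≤ k := by ext; simp
  rw [this, Finset.sum_filter]
  simp only [upper, ContinuousLinearMap.pi_apply, sum_apply, hi, true_and]
  exact Finset.sum_congr rfl fun k _ => by split_ifs <;> rfl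

theorem upper_apply_of_lt {m : ℕ} {i : Fin N} (hi : i.val < m) (x v : State n) :
    upper f m x v i = 0 := by
  simp [upper, hi.not_ge]

/-- A map into the product is the finite sum of its components composed with the fixed inclusions,
which makes continuity in operator norm visible. -/
theorem continuous_clm_pi : Continuous fun A : (∀ i : Fin N, State n →L[ℝ]
    EuclideanSpace ℝ (Fin (n i))) => (ContinuousLinearMap.pi A : State n →L[ℝ] State n) := by
  have : (fun A : (∀ i : Fin N, State n →L[ℝ] EuclideanSpace ℝ (Fin (n i))) =>
      (ContinuousLinearMap.pi A : State n →L[ℝ] State n)) = fun A => ∑ i,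
        (ContinuousLinearMap.single ℝ (fun i : Fin N => EuclideanSpace ℝ (Fin (n i))) i).comp
          (A i) := by
    funext A
    ext v : 1
    simp only [sum_apply, ContinuousLinearMap.comp_apply, ContinuousLinearMap.single_apply]
    exact (Finset.univ_sum_single (fun i => A i v)).symm
  rw [this]
  exact continuous_finsetSum _ fun i _ => continuous_const.clm_comp (continuous_apply i)

theorem continuousAt_upper (hf : ∀ i, ContDiff ℝ 1 (f i)) {m : ℕ} {x : State n}
    (hx : TailRegular f (m + 1) x) : ContinuousAt (upper f m) x := by
  refine continuous_clm_pi.continuousAt.comp (continuousAt_pi.2 fun i => tendsto_finsetSum _ fun k _ => ?_)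
  split_ifs with h
  · have h1 : ContinuousAt (fun y => totalD f y i k) x := continuousAt_totalD hf i k
      (hx.mono (by rw [max_eq_right h.2]; have := h.1; have : i.val ≤ k.val := h.2; omega))
    exact h1.clm_comp continuousAt_const
  · exact tendsto_const_nhds

/-! ### Completion by steady-state maps -/

theorem fill_of_lt {ξ : ∀ k : Fin N, Slower n k → EuclideanSpace ℝ (Fin (n k))} {m : ℕ} {k : Fin N}
    (hk : k.val < m) (x : State n) : fill ξ m x k = x k := by
  rw [fill, if_pos hk]

theorem fill_of_le {ξ : ∀ k : Fin N, Slower n k → EuclideanSpace ℝ (Fin (n k))} {m : ℕ} {k : Fin N}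
    (hk : m ≤ k.val) (x : State n) : fill ξ m x k = ξ k (slower k (fill ξ m x)) := by
  rw [fill, if_neg hk.not_gt]; rfl

/-- The completion is determined by its head and by the equations of its tail, by recursion from the
slowest block. Completions are compared through this uniqueness. -/
theorem eq_fill {ξ : ∀ k : Fin N, Slower n k → EuclideanSpace ℝ (Fin (n k))} {m : ℕ}
    {x y : State n} (h0 : ∀ k : Fin N, k.val < m → y k = x k)
    (h1 : ∀ k : Fin N, m ≤ k.val → y k = ξ k (slower k y)) : y = fill ξ m x := by
  have key : ∀ d : ℕ, ∀ k : Fin N, k.val = d → y k = fill ξ m x k := by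
    intro d
    induction d using Nat.strong_induction_on with
    | _ d ih =>
      intro k hk
      rcases lt_or_ge k.val m with h | h
      · rw [fill_of_lt h, h0 k h]
      · rw [fill_of_le h, h1 k h]
        exact congrArg _ (funext fun j => ih j.1.val (hk ▸ j.2) j.1 rfl)
  funext k
  exact key _ k rfl

theorem fill_congr {ξ : ∀ k : Fin N, Slower n k → EuclideanSpace ℝ (Fin (n k))} {m : ℕ}
    {x y : State n} (h : ∀ k : Fin N, k.val < m → x k = y k) : fill ξ m x = fill ξ m y :=
  eq_fill (fun k hk => by rw [fill_of_lt hk, h k hk]) fun k hk => fill_of_le hk x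

theorem SteadyMaps.tracks_iff (B : SteadyMaps f) {p : Fin N} {x : State n} :
    B.Tracks p x ↔ fill B.map p.val x = x :=
  ⟨fun h => (eq_fill (fun _ _ => rfl) fun k hk => h k hk).symm,
    fun h k hk => by conv_lhs => rw [← h, fill_of_le hk, h]⟩

theorem SteadyMaps.tracks_fill (B : SteadyMaps f) (p : Fin N) (x : State n) :
    B.Tracks p (fill B.map p.val x) := fun _ hk => fill_of_le hk x

/-- The structure gives only f_p = 0 at a completion from p. For k ≥ p, completing again from k
changes nothing, so the field `steady` of index k applies. -/
theorem SteadyMaps.steady_fill (B : SteadyMaps f) {p : Fin N} {x : State n}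
    (hx : slower p x ∈ B.dom p) {k : Fin N} (hk : p ≤ k) : f k (fill B.map p.val x) = 0 := by
  have h := B.steady k _ (B.slower_fill_mem p x hx k hk)
  rwa [← eq_fill (fun _ _ => rfl) fun l hl => fill_of_le (le_trans (show p.val ≤ k.val from hk) hl) x]
    at h

theorem continuous_slower (i : Fin N) : Continuous (slower i : State n → Slower n i) :=
  continuous_pi fun j => continuous_apply j.1

theorem SteadyMaps.eventually_slower_mem (B : SteadyMaps f) {p : Fin N} {x : State n}
    (hx : slower p x ∈ B.dom p) : ∀ᶠ y in 𝓝 x, slower p y ∈ B.dom p :=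
  (continuous_slower p).continuousAt ((B.isOpen_dom p).mem_nhds hx)

theorem SteadyMaps.continuousAt_fill (B : SteadyMaps f) {p : Fin N} {x : State n}
    (hx : slower p x ∈ B.dom p) : ContinuousAt (fill B.map p.val) x := by
  have key : ∀ d : ℕ, ∀ k : Fin N, k.val = d →
      ContinuousAt (fun y => fill B.map p.val y k) x := by
    intro d
    induction d using Nat.strong_induction_on with
    | _ d ih =>
      intro k hk
      rcases lt_or_ge k.val p.val with h | h
      · simp only [fill_of_lt h]
        exact continuousAt_apply k x
      · simp only [fill_of_le h]
        refine ContinuousAt.comp (g := B.map k)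
          (f := fun y => slower k (fill B.map p.val y)) ?_ ?_
        · exact (B.continuousOn_map k).continuousAt
            ((B.isOpen_dom k).mem_nhds (B.slower_fill_mem p x hx k h))
        · exact continuousAt_pi.2 fun j => ih j.1.val (hk ▸ j.2) j.1 rfl
  exact continuousAt_pi.2 fun k => key _ k rfl

/-- The projection `x ↦ (x_1, …, x_m, 0, …, 0)`. -/
def headProj (n : Fin N → ℕ) (m : ℕ) : State n →L[ℝ] State n :=
  ContinuousLinearMap.pi fun i => if i.val < m then ContinuousLinearMap.proj i else 0

theorem headProj_of_lt {m : ℕ} {i : Fin N} (h : i.val < m) (x : State n) :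
    headProj n m x i = x i := by simp [headProj, h]

theorem headProj_of_le {m : ℕ} {i : Fin N} (h : m ≤ i.val) (x : State n) :
    headProj n m x i = 0 := by simp [headProj, h.not_gt]

theorem tailMap_eq_headProj {m : ℕ} {x : State n} (h : ∀ k : Fin N, m ≤ k.val → f k x = 0) :
    tailMap f m x = headProj n m x := by
  funext k
  rcases lt_or_ge k.val m with hk | hk
  · rw [tailMap_of_lt hk, headProj_of_lt hk]
  · rw [tailMap_of_le hk, headProj_of_le hk, h k hk]

/-- The link between steady-state maps and the inverse function theorem: a completion is a preimage
of (x_1, …, x_m, 0, …, 0) under `tailMap f m`. -/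
theorem tailMap_fill {ξ : ∀ k : Fin N, Slower n k → EuclideanSpace ℝ (Fin (n k))} {m : ℕ}
    {x : State n} (h : ∀ k : Fin N, m ≤ k.val → f k (fill ξ m x) = 0) :
    tailMap f m (fill ξ m x) = headProj n m x := by
  rw [tailMap_eq_headProj h]
  funext k
  rcases lt_or_ge k.val m with hk | hk
  · rw [headProj_of_lt hk, headProj_of_lt hk, fill_of_lt hk]
  · rw [headProj_of_le hk, headProj_of_le hk]

/-- Continuous steady-state maps are differentiable at the points where the systems `k ≥ m` are
regular. -/
theorem exists_hasFDerivAt_fill (hf : ∀ i, ContDiff ℝ 1 (f i))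
    {ξ : ∀ k : Fin N, Slower n k → EuclideanSpace ℝ (Fin (n k))} {m : ℕ} {x : State n}
    (hc : ContinuousAt (fill ξ m) x)
    (hz : ∀ᶠ y in 𝓝 x, ∀ k : Fin N, m ≤ k.val → f k (fill ξ m y) = 0)
    (hx : TailRegular f m (fill ξ m x)) :
    ∃ φ : State n →L[ℝ] State n, HasFDerivAt (fill ξ m) φ x ∧
      ∀ v, tailD f m (fill ξ m x) (φ v) = headProj n m v := by
  have h := hasStrictFDerivAt_tailMap_equiv hf hx
  have h1 := h.to_localInverse.hasFDerivAt
  have hx0 := tailMap_fill hz.self_of_nhds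
  rw [hx0] at h1
  have h2 := h1.comp x (headProj n m).hasFDerivAt
  refine ⟨_, h2.congr_of_eventuallyEq ?_, fun v => ?_⟩
  -- Continuity keeps the completion in the region where the local inverse undoes `tailMap f m`, so
  -- near x it is the local inverse composed with the head projection.
  · filter_upwards [hz, hc.eventually h.eventually_left_inverse] with y hy hy'
    rw [← hy', tailMap_fill hy]; rfl
  · exact (equivOfInjective _ (tailD_injective hf hx)).apply_symm_apply _

/-! ### Uniqueness for differential equations -/

/-- The coincidence set is closed by continuity, open by hypothesis and nonempty, and I is
connected. -/
theorem eqOn_of_eventually_eq {E : Type*} [TopologicalSpace E] [T2Space E] {I : Set ℝ}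
    (hI : I.OrdConnected) {x y : ℝ → E} (hx : ContinuousOn x I) (hy : ContinuousOn y I) {t₀ : ℝ}
    (ht₀ : t₀ ∈ I) (h0 : x t₀ = y t₀)
    (h : ∀ t ∈ I, x t = y t → ∀ᶠ s in 𝓝[I] t, x s = y s) : EqOn x y I := by
  have : PreconnectedSpace I := Subtype.preconnectedSpace hI.isPreconnected
  have hS : IsClopen {s : I | x s = y s} := by
    refine ⟨isClosed_eq (continuousOn_iff_continuous_domRestrict.1 hx)
      (continuousOn_iff_continuous_domRestrict.1 hy), isOpen_iff_mem_nhds.2 fun t ht => ?_⟩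
    rw [nhds_subtype_eq_comap_nhdsWithin]
    exact ⟨_, h t t.2 ht, fun s hs => hs⟩
  have := hS.eq_univ ⟨⟨t₀, ht₀⟩, h0⟩
  exact fun t ht => (this.symm ▸ mem_univ (⟨t, ht⟩ : I) : (⟨t, ht⟩ : I) ∈ {s : I | x s = y s})

section Gronwall

variable {E : Type*} [NormedAddCommGroup E] [NormedSpace ℝ E] {u u' : ℝ → E} {K : ℝ}

theorem hasDerivWithinAt_Ici_of_Icc {a b s : ℝ} {v : E} (h : HasDerivWithinAt u v (Icc a b) s)
    (hs : s ∈ Ico a b) : HasDerivWithinAt u v (Ici s) s :=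
  (h.mono (Icc_subset_Icc_left hs.1)).mono_of_mem_nhdsWithin (Icc_mem_nhdsGE hs.2)

theorem eq_zero_of_norm_deriv_le_right {a b : ℝ} (hab : a ≤ b)
    (h : ∀ t ∈ Icc a b, HasDerivWithinAt u (u' t) (Icc a b) t ∧ ‖u' t‖ ≤ K * ‖u t‖)
    (h0 : u a = 0) : u b = 0 :=
  eq_zero_of_abs_deriv_le_mul_abs_self_of_eq_zero_right
    (fun t ht => (h t ht).1.continuousWithinAt)
    (fun t ht => hasDerivWithinAt_Ici_of_Icc (h t (Ico_subset_Icc_self ht)).1 ht) h0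
    (fun t ht => (h t (Ico_subset_Icc_self ht)).2) b (right_mem_Icc.2 hab)

/-- Grönwall to the right of t₀, and after time reversal to the left. -/
theorem eq_zero_of_norm_deriv_le {I : Set ℝ} (hI : I.OrdConnected)
    (h : ∀ t ∈ I, HasDerivWithinAt u (u' t) I t ∧ ‖u' t‖ ≤ K * ‖u t‖) {t₀ : ℝ} (ht₀ : t₀ ∈ I)
    (h0 : u t₀ = 0) {t : ℝ} (ht : t ∈ I) : u t = 0 := by
  rcases le_total t₀ t with hle | hle
  · have hs : Icc t₀ t ⊆ I := hI.out ht₀ ht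
    exact eq_zero_of_norm_deriv_le_right hle
      (fun s hs' => ⟨(h s (hs hs')).1.mono hs, (h s (hs hs')).2⟩) h0
  · have hs : Icc t t₀ ⊆ I := hI.out ht ht₀
    have hm : MapsTo (fun s : ℝ => -s) (Icc (-t₀) (-t)) I := fun s hs' =>
      hs ⟨le_neg.1 hs'.2, neg_le.1 hs'.1⟩
    have := eq_zero_of_norm_deriv_le_right (u := fun s => u (-s)) (u' := fun s => -u' (-s)) (K := K)
      (neg_le_neg hle) (fun s hs' => ⟨by
        simpa [Function.comp_def] using
          (h (-s) (hm hs')).1.scomp s (hasDerivAt_neg s).hasDerivWithinAt hm, by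
        simpa using (h (-s) (hm hs')).2⟩) (by simpa using h0)
    simpa using this

theorem eventually_eq_zero_of_norm_deriv_le {I : Set ℝ} (hI : I.OrdConnected) {t₀ : ℝ}
    (ht₀ : t₀ ∈ I)
    (h : ∀ᶠ t in 𝓝[I] t₀, HasDerivWithinAt u (u' t) I t ∧ ‖u' t‖ ≤ K * ‖u t‖)
    (h0 : u t₀ = 0) : ∀ᶠ t in 𝓝[I] t₀, u t = 0 := by
  obtain ⟨ε, hε, hs⟩ := Metric.mem_nhdsWithin_iff.1 h
  have hJ : (Metric.ball t₀ ε ∩ I).OrdConnected := by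
    rw [Real.ball_eq_Ioo]; exact ordConnected_Ioo.inter hI
  filter_upwards [inter_mem_nhdsWithin I (Metric.ball_mem_nhds t₀ hε)] with t ht
  exact eq_zero_of_norm_deriv_le hJ
    (fun s hs' => ⟨(hs hs').1.mono inter_subset_right, (hs hs').2⟩)
    ⟨Metric.mem_ball_self hε, ht₀⟩ h0 ⟨ht.2, ht.1⟩

/-- A solution of an autonomous differential equation is unique if the vector field is Lipschitz
near each of its points. -/
theorem eqOn_of_hasDerivWithinAt {F : E → E} {I : Set ℝ} (hI : I.OrdConnected) {x y : ℝ → E}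
    (hx : ∀ t ∈ I, HasDerivWithinAt x (F (x t)) I t)
    (hy : ∀ t ∈ I, HasDerivWithinAt y (F (y t)) I t)
    (hF : ∀ t ∈ I, ∃ K : NNReal, ∃ s ∈ 𝓝 (x t), LipschitzOnWith K F s) {t₀ : ℝ} (ht₀ : t₀ ∈ I)
    (h0 : y t₀ = x t₀) : EqOn y x I := by
  refine eqOn_of_eventually_eq hI (fun t ht => (hy t ht).continuousWithinAt)
    (fun t ht => (hx t ht).continuousWithinAt) ht₀ h0 fun t ht hyx => ?_
  obtain ⟨K, s, hs, hK⟩ := hF t ht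
  have hxs : ∀ᶠ r in 𝓝[I] t, x r ∈ s := (hx t ht).continuousWithinAt hs
  have hys : ∀ᶠ r in 𝓝[I] t, y r ∈ s := (hy t ht).continuousWithinAt (hyx.symm ▸ hs)
  have := eventually_eq_zero_of_norm_deriv_le (u := fun r => y r - x r)
    (u' := fun r => F (y r) - F (x r)) (K := K) hI ht ?_ (sub_eq_zero.2 hyx)
  · filter_upwards [this] with r hr using sub_eq_zero.1 hr
  · filter_upwards [hxs, hys, self_mem_nhdsWithin] with r hr hr' hrI
    exact ⟨(hy r hrI).sub (hx r hrI), hK.norm_sub_le hr' hr⟩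

end Gronwall

theorem isSolution_iff {I : Set ℝ} {x : ℝ → State n} :
    IsSolution f I x ↔ ∀ t ∈ I, HasDerivWithinAt x (predField f (x t)) I t := by
  constructor
  · rintro ⟨x', h⟩ t ht
    rw [← (condM_eq_iff f (x t) (x' t)).1 (h t ht).2]
    exact (h t ht).1
  · exact fun h => ⟨fun t => predField f (x t), fun t ht => ⟨h t ht, (condM_eq_iff f _ _).2 rfl⟩⟩

theorem IsSolution.isSolutionFrom {I : Set ℝ} {x : ℝ → State n} (h : IsSolution f I x)
    (p : Fin N) : IsSolutionFrom f p I x :=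
  ⟨fun t => predField f (x t), fun t ht => ⟨isSolution_iff.1 h t ht,
    fun i _ => predField_apply f (x t) i⟩⟩

/-- A solution through regular points is unique. -/
theorem IsSolution.eqOn (hf : ∀ i, ContDiff ℝ 1 (f i))
    (hF : LocallyLipschitzOn {x | Regular f x} (predField f)) {I : Set ℝ} (hI : I.OrdConnected)
    {x y : ℝ → State n} (hx : IsSolution f I x) (hy : IsSolution f I y)
    (hreg : ∀ t ∈ I, Regular f (x t)) {t₀ : ℝ} (ht₀ : t₀ ∈ I) (h0 : y t₀ = x t₀) : EqOn y x I := by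
  refine eqOn_of_hasDerivWithinAt hI (isSolution_iff.1 hx) (isSolution_iff.1 hy) (fun t ht => ?_)
    ht₀ h0
  obtain ⟨K, s, hs, hK⟩ := hF (hreg t ht)
  rw [(isOpen_setOf_regular hf).nhdsWithin_eq (hreg t ht)] at hs
  exact ⟨K, s, hs, hK⟩

/-! ### Tracking -/

theorem IsSolutionFrom.continuousOn {p : Fin N} {I : Set ℝ} {x : ℝ → State n}
    (h : IsSolutionFrom f p I x) : ContinuousOn x I := fun t ht =>
  (h.choose_spec t ht).1.continuousWithinAt

/-- Along the solutions of the systems `i ≥ p`, the right-hand sides `f_i`, `i ≥ p`, obey a linear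
differential equation; they stay zero if they are zero at one time. -/
theorem eventually_eq_zero_of_isSolutionFrom (hf : ∀ i, ContDiff ℝ 1 (f i)) {p : Fin N} {I : Set ℝ}
    (hI : I.OrdConnected) {x : ℝ → State n} (hsol : IsSolutionFrom f p I x) {t : ℝ} (ht : t ∈ I)
    (hreg : TailRegular f (max p.val 1) (x t)) (hz : ∀ k, p ≤ k → f k (x t) = 0) :
    ∀ᶠ s in 𝓝[I] t, ∀ k, p ≤ k → f k (x s) = 0 := by
  have hcx := hsol.continuousOn t ht
  obtain ⟨x', hx'⟩ := hsol
  have hA : ContinuousAt (upper f p.val) (x t) := continuousAt_upper hf (hreg.mono (by omega))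
  have hb : ∀ᶠ y in 𝓝 (x t), ‖upper f p.val y‖ ≤ ‖upper f p.val (x t)‖ + 1 :=
    (hA.norm.eventually_lt continuousAt_const (lt_add_one _)).mono fun y hy => le_of_lt hy
  -- The slower blocks are set to zero. Since U is upper triangular, its rows k ≥ p see only the
  -- blocks l ≥ p, so u satisfies a closed linear equation.
  let u : ℝ → State n := fun s k => if p ≤ k then f k (x s) else 0
  have hu : ∀ s k, p ≤ k → u s k = f k (x s) := fun s k hk => if_pos hk
  have := eventually_eq_zero_of_norm_deriv_le (u := u)
    (u' := fun s => upper f p.val (x s) (u s)) (K := ‖upper f p.val (x t)‖ + 1) hI ht ?_ ?_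
  · filter_upwards [this] with s hs k hk
    rw [← hu s k hk, hs]; rfl
  · filter_upwards [self_mem_nhdsWithin, hcx.eventually hb,
      hcx.eventually (eventually_tailRegular hf hreg)] with s hs hs1 hs2
    refine ⟨hasDerivWithinAt_pi.2 fun k => ?_, ?_⟩
    · by_cases hk : p ≤ k
      · simp only [u, hk, if_true]
        have hdk : DifferentiableAt ℝ (f k) (x s) := (hf k).differentiable one_ne_zero _
        have h1 := hdk.hasFDerivAt.comp_hasDerivWithinAt s (hx' s hs).1
        convert! h1 using 1
        have hk' : p.val ≤ k.val := hk
        rw [upper_apply hk', fderiv_apply_eq_sum_totalD hdk fun h0 => hs2 k (by omega)]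
        refine Finset.sum_congr rfl fun l hl => ?_
        have hl : p ≤ l := hk.trans (Finset.mem_Ici.1 hl)
        -- Row l ≥ p of the dynamics reads (M ẋ)_l = f_l, so ∇f_k ẋ = (U M ẋ)_k becomes (U u)_k.
        rw [condM_apply, (hx' s hs).2 l hl, add_sub_cancel_right, if_pos hl]
      · simp only [u, hk, if_false]
        rw [upper_apply_of_lt (not_le.1 hk)]
        exact hasDerivWithinAt_const _ _ _
    · exact (ContinuousLinearMap.le_opNorm _ _).trans (by gcongr)
  · funext k
    by_cases hk : p ≤ k
    · rw [hu t k hk, hz k hk]; rfl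
    · exact if_neg hk

/-- The times at which the curve equals its completion form an open set: from such a time on both
sides f_k, k ≥ p, stays zero nearby, so the curve and its completion have the same image under the
locally injective `tailMap f p`. -/
theorem SteadyMaps.tracks_of_isSolutionFrom (hf : ∀ i, ContDiff ℝ 1 (f i)) (B : SteadyMaps f)
    {p : Fin N} {I : Set ℝ} (hI : I.OrdConnected) {x : ℝ → State n}
    (hdom : ∀ t ∈ I, slower p (x t) ∈ B.dom p)
    (hreg : ∀ t ∈ I, B.Tracks p (x t) → TailRegular f (max p.val 1) (x t))
    (hsol : IsSolutionFrom f p I x) {t₀ : ℝ} (ht₀ : t₀ ∈ I) (h0 : B.Tracks p (x t₀)) :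
    ∀ t ∈ I, B.Tracks p (x t) := by
  have hcx := hsol.continuousOn
  have hcf : ContinuousOn (fun t => fill B.map p.val (x t)) I := fun t ht =>
    (B.continuousAt_fill (hdom t ht)).comp_continuousWithinAt (hcx t ht)
  suffices EqOn (fun t => fill B.map p.val (x t)) x I from fun t ht => B.tracks_iff.2 (this ht)
  refine eqOn_of_eventually_eq hI hcf hcx ht₀ (B.tracks_iff.1 h0) fun t ht hxt => ?_
  have hregt := hreg t ht (B.tracks_iff.2 hxt)
  have hzt : ∀ k, p ≤ k → f k (x t) = 0 := fun k hk => by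
    have := B.steady_fill (hdom t ht) hk
    rwa [hxt] at this
  have hz := eventually_eq_zero_of_isSolutionFrom hf hI hsol ht hregt hzt
  -- When p is the slowest system, D_{x_1} f_1 may be singular and local injectivity is unavailable.
  -- But then f = 0 near t, so M ẋ = 0, ẋ = 0, and the curve is locally constant.
  rcases Nat.eq_zero_or_pos p.val with hp | hp
  · obtain ⟨x', hx'⟩ := hsol
    have := eventually_eq_zero_of_norm_deriv_le (u := fun s => x s - x t) (u' := x') (K := 0) hI ht
      ?_ (sub_self _)
    · filter_upwards [this] with s hs
      rw [sub_eq_zero.1 hs, hxt]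
    · filter_upwards [hz, self_mem_nhdsWithin] with s hs hsI
      have h0 : x' s = 0 := condM_injective (f := f) (x s) (by
        rw [map_zero]
        funext i
        have hi : p ≤ i := Fin.le_def.2 (by omega)
        rw [condM_apply, (hx' s hsI).2 i hi, add_sub_cancel_right, hs i hi]; rfl)
      exact ⟨(hx' s hsI).1.sub_const _, by simp [h0]⟩
  · rw [max_eq_left (by omega)] at hregt
    have hinv := (hasStrictFDerivAt_tailMap_equiv hf hregt).eventually_left_inverse
    have h2 := hcf t ht
    rw [ContinuousWithinAt, hxt] at h2
    filter_upwards [hz, (hcx t ht).eventually hinv, h2.eventually hinv, self_mem_nhdsWithin]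
      with s hs h3 h4 hsI
    rw [tailMap_fill fun k hk => B.steady_fill (hdom s hsI) hk] at h4
    rw [tailMap_eq_headProj fun k hk => hs k hk] at h3
    exact h4.symm.trans h3

/-- Along the completed curve f_k vanishes identically for k ≥ p, so ∇f_k annihilates its velocity.
Back substitution turns this into (M ẋ)_k = 0 = f_k, which is Σ_k. -/
theorem SteadyMaps.isSolutionFrom_fill (hf : ∀ i, ContDiff ℝ 1 (f i)) (B : SteadyMaps f)
    {p : Fin N} {I : Set ℝ} {x : ℝ → State n} (hdom : ∀ t ∈ I, slower p (x t) ∈ B.dom p)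
    (hreg : ∀ t ∈ I, TailRegular f (max p.val 1) (fill B.map p.val (x t)))
    (hd : ∀ j, j < p → DifferentiableOn ℝ (fun t => x t j) I) :
    IsSolutionFrom f p I (fun t => fill B.map p.val (x t)) := by
  rcases Nat.eq_zero_or_pos p.val with hp | hp
  · refine ⟨fun _ => 0, fun t ht => ⟨?_, fun i hi => ?_⟩⟩
    · have : (fun t => fill B.map p.val (x t)) = fun _ => fill B.map p.val (x t) :=
        funext fun s => fill_congr fun k hk => absurd hk (by omega)
      rw [this]
      exact hasDerivWithinAt_const _ _ _
    · simp [B.steady_fill (hdom t ht) hi]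
  · rw [max_eq_left (by omega)] at hreg
    -- The blocks k ≥ p of x are arbitrary, possibly not differentiable; the completion ignores
    -- them.
    have hhead : ∀ y : State n, fill B.map p.val (headProj n p.val y) = fill B.map p.val y :=
      fun y => fill_congr fun k hk => headProj_of_lt hk y
    have hslow : ∀ y : State n, slower p (headProj n p.val y) = slower p y :=
      fun y => funext fun j => headProj_of_lt j.2 y
    have hh : ∀ t ∈ I, DifferentiableWithinAt ℝ (fun s => headProj n p.val (x s)) I t := by
      intro t ht
      refine differentiableWithinAt_pi.2 fun k => ?_
      rcases lt_or_ge k.val p.val with hk | hk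
      · simp only [headProj_of_lt hk]; exact hd k hk t ht
      · simp only [headProj_of_le hk]; exact differentiableWithinAt_const _
    have key : ∀ t ∈ I, ∃ v, HasDerivWithinAt (fun s => fill B.map p.val (x s)) v I t ∧
        ∀ k, p ≤ k → fderiv ℝ (f k) (fill B.map p.val (x t)) v = 0 := by
      intro t ht
      have hm : slower p (headProj n p.val (x t)) ∈ B.dom p := by
        rw [hslow]; exact hdom t ht
      obtain ⟨φ, h1, h2⟩ := exists_hasFDerivAt_fill hf (B.continuousAt_fill hm)
        ((B.eventually_slower_mem hm).mono fun y hy k hk => B.steady_fill hy hk)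
        (by rw [hhead]; exact hreg t ht)
      refine ⟨_, (h1.comp_hasDerivWithinAt t (hh t ht).hasDerivWithinAt).congr_of_mem
        (fun s _ => (hhead (x s)).symm) ht, fun k hk => ?_⟩
      rw [← hhead (x t), ← tailD_of_le (show p.val ≤ k.val from hk), h2, headProj_of_le hk]
    choose! x' hx' using key
    refine ⟨x', fun t ht => ⟨(hx' t ht).1, fun i hi => ?_⟩⟩
    have h3 := condM_eq_zero_of_fderiv_eq_zero (fun i => (hf i).differentiable one_ne_zero _)
      (hreg t ht) (fun k hk => (hx' t ht).2 k hk) i hi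
    rw [condM_apply, sub_eq_zero] at h3
    rw [B.steady_fill (hdom t ht) hi, zero_add, h3]

/-! ### Existence of solutions -/

theorem exists_isSolution_Ioo (hf : ∀ i, ContDiff ℝ 1 (f i))
    (hF : LocallyLipschitzOn {x | Regular f x} (predField f)) {x₀ : State n} (h0 : Regular f x₀)
    (t₀ : ℝ) {W : Set (State n)} (hW : W ∈ 𝓝 x₀) :
    ∃ ε > 0, ∃ x : ℝ → State n, x t₀ = x₀ ∧ IsSolution f (Ioo (t₀ - ε) (t₀ + ε)) x ∧
      ∀ t ∈ Ioo (t₀ - ε) (t₀ + ε), x t ∈ W := by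
  obtain ⟨K, s, hs, hK⟩ := hF h0
  rw [(isOpen_setOf_regular hf).nhdsWithin_eq h0] at hs
  obtain ⟨a, ha, has⟩ := Metric.nhds_basis_closedBall.mem_iff.1 hs
  -- On the ball of radius a, ‖F‖ ≤ K a + ‖F(x₀)‖; the added 1 makes L positive. A solution of speed
  -- at most L stays in the ball for time a / L.
  let L : NNReal := K * a.toNNReal + ‖predField f x₀‖₊ + 1
  have hL : (L : ℝ) = K * a + ‖predField f x₀‖ + 1 := by simp [L, ha.le]
  have hL0 : 0 < (L : ℝ) := by rw [hL]; positivity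
  have hδ : 0 < a / L := div_pos ha hL0
  have hpl : IsPicardLindelof (fun _ => predField f) (tmin := t₀ - a / L) (tmax := t₀ + a / L)
      ⟨t₀, by constructor <;> linarith⟩ x₀ a.toNNReal 0 L K := by
    refine IsPicardLindelof.of_time_independent (fun x hx => ?_) ?_ ?_
    · rw [Real.coe_toNNReal _ ha.le] at hx
      have h1 := hK.norm_sub_le (has hx) (has (Metric.mem_closedBall_self ha.le))
      have h2 : ‖x - x₀‖ ≤ a := by rw [← dist_eq_norm]; exact hx
      have h3 : (K : ℝ) * ‖x - x₀‖ ≤ K * a := by gcongr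
      have h4 := norm_sub_norm_le (predField f x) (predField f x₀)
      rw [hL]; linarith
    · rw [Real.coe_toNNReal _ ha.le]; exact hK.mono has
    · rw [Real.coe_toNNReal _ ha.le]
      have : max (t₀ + a / L - t₀) (t₀ - (t₀ - a / L)) = a / L := by
        rw [add_sub_cancel_left, sub_sub_cancel, max_self]
      simp only [this, NNReal.coe_zero, sub_zero]
      rw [mul_div_cancel₀ _ hL0.ne']
  obtain ⟨x, hx0, hx⟩ := hpl.exists_eq_forall_mem_Icc_hasDerivWithinAt₀
  have hx0 : x t₀ = x₀ := hx0
  have hIcc : Icc (t₀ - a / L) (t₀ + a / L) ∈ 𝓝 t₀ :=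
    Icc_mem_nhds (by linarith) (by linarith)
  have hxc : ContinuousAt x t₀ :=
    ((hx t₀ (mem_of_mem_nhds hIcc)).hasDerivAt hIcc).continuousAt
  obtain ⟨ε, hε, hball⟩ := Metric.mem_nhds_iff.1 (inter_mem hIcc (hxc (hx0.symm ▸ hW)))
  rw [Real.ball_eq_Ioo] at hball
  refine ⟨ε, hε, x, hx0, isSolution_iff.2 fun t ht => ?_, fun t ht => (hball ht).2⟩
  exact (hx t (hball ht).1).mono fun s hs => (hball hs).1

/-! ### The Jacobian at a steady state -/

theorem SteadyMaps.Through.fill_eq {B : SteadyMaps f} {xs : State n} (h : B.Through xs) {m : ℕ}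
    (hm : 0 < m) : fill B.map m xs = xs :=
  (eq_fill (fun _ _ => rfl) fun k hk => (h k (hm.trans_le hk)).2).symm

theorem SteadyMaps.Through.continuousAt_fill {B : SteadyMaps f} {xs : State n} (h : B.Through xs)
    {m : ℕ} (hm : 0 < m) : ContinuousAt (fill B.map m) xs := by
  by_cases hN : m < N
  · exact B.continuousAt_fill (p := ⟨m, hN⟩) (h ⟨m, hN⟩ hm).1
  -- The case m ≥ N is needed for the fastest system, whose reduced vector field is f_N itself.
  · have : fill B.map m = id := funext fun y =>
      funext fun k => fill_of_lt (k.isLt.trans_le (not_lt.1 hN)) y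
    rw [this]
    exact continuousAt_id

theorem SteadyMaps.Through.eventually_steady {B : SteadyMaps f} {xs : State n} (h : B.Through xs)
    {m : ℕ} (hm : 0 < m) : ∀ᶠ y in 𝓝 xs, ∀ k : Fin N, m ≤ k.val → f k (fill B.map m y) = 0 := by
  by_cases hN : m < N
  · exact (B.eventually_slower_mem (h ⟨m, hN⟩ hm).1).mono fun y hy k hk =>
      B.steady_fill (p := ⟨m, hN⟩) hy hk
  · exact Eventually.of_forall fun y k hk => absurd (hk.trans_lt k.isLt) hN

/-- Moving x_i by v moves the completion by a vector w with zero blocks before i, w_i = v, and ∇f_k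
w = 0 for k > i. Then M w is concentrated in block i, and ∇f_i w = (U M w)_i = D_{x_i} f_i v. -/
theorem hasFDerivAt_reduced (hf : ∀ i, ContDiff ℝ 1 (f i)) {B : SteadyMaps f} {xs : State n}
    (h : B.Through xs) (hreg : Regular f xs) (i : Fin N) :
    HasFDerivAt (fun z => reduced f B i (Function.update xs i z)) (totalD f xs i i) (xs i) := by
  have hm : 0 < i.val + 1 := Nat.succ_pos _
  have hfill := h.fill_eq hm
  obtain ⟨φ, h1, h2⟩ := exists_hasFDerivAt_fill hf (h.continuousAt_fill hm)
    (h.eventually_steady hm) (by rw [hfill]; exact hreg.tailRegular hm)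
  have hd : ∀ k, DifferentiableAt ℝ (f k) xs := fun k => (hf k).differentiable one_ne_zero xs
  have h3 : HasFDerivAt (fun y => reduced f B i y) ((fderiv ℝ (f i) xs).comp φ) xs := by
    have := (hd i).hasFDerivAt
    rw [← hfill] at this
    have := this.comp xs h1
    rwa [hfill] at this
  have h4 : HasFDerivAt (fun y => reduced f B i y) ((fderiv ℝ (f i) xs).comp φ)
      (Function.update xs i (xs i)) := by rwa [Function.update_eq_self]
  refine (h4.comp (xs i) (hasFDerivAt_update xs (xs i))).congr_fderiv ?_
  ext v : 1
  rw [hfill] at h2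
  have hw : ∀ k, k ≤ i → φ (Pi.single i v) k = (Pi.single i v : State n) k := fun k hk => by
    have hk' : k.val < i.val + 1 := Nat.lt_succ_of_le hk
    rw [← tailD_of_lt (f := f) hk' xs (φ (Pi.single i v)), h2, headProj_of_lt hk']
  calc fderiv ℝ (f i) xs (φ ((ContinuousLinearMap.pi (Pi.single i (ContinuousLinearMap.id ℝ
      (EuclideanSpace ℝ (Fin (n i)))))) v))
      = fderiv ℝ (f i) xs (φ (Pi.single i v)) := by rw [pi_single_id_apply]
    _ = totalD f xs i i (φ (Pi.single i v) i) := by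
      refine fderiv_apply_eq_totalD (hd i) (condM_eq_single hd (hreg.tailRegular hm)
        (fun k hk => ?_) fun k hk => ?_) le_rfl (hreg i)
      · rw [hw k hk.le, Pi.single_eq_of_ne hk.ne]
      · rw [← tailD_of_le (show i.val + 1 ≤ k.val from hk), h2,
          headProj_of_le (show i.val + 1 ≤ k.val from hk)]
    _ = totalD f xs i i v := by rw [hw i le_rfl, Pi.single_eq_same]

theorem predField_eq_inverse (x : State n) :
    predField f x = (condM f x).inverse fun i => f i x := by
  rw [← (condM_eq_iff f x (predField f x)).2 rfl,
    (isInvertible_of_injective (condM_injective x)).inverse_apply_self]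

/-- A product rule in which A need only be continuous: since g(x) = 0, the error (A y - A x) g(y) is
o(1) · O(‖y - x‖). This suits A = M⁻¹, which involves first derivatives of the merely C¹ map f. -/
theorem hasFDerivAt_clm_apply_of_eq_zero {E F G : Type*} [NormedAddCommGroup E] [NormedSpace ℝ E]
    [NormedAddCommGroup F] [NormedSpace ℝ F] [NormedAddCommGroup G] [NormedSpace ℝ G]
    {A : E → F →L[ℝ] G} {g : E → F} {g' : E →L[ℝ] F} {x : E} (hA : ContinuousAt A x)
    (hg : HasFDerivAt g g' x) (h0 : g x = 0) :
    HasFDerivAt (fun y => A y (g y)) ((A x).comp g') x := by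
  rw [hasFDerivAt_iff_isLittleO]
  have hsplit : (fun y => A y (g y) - A x (g x) - ((A x).comp g') (y - x)) =
      fun y => (A y - A x) (g y) + A x (g y - g x - g' (y - x)) := by
    funext y
    simp only [h0, map_zero, map_sub, sub_zero, ContinuousLinearMap.comp_apply,
      sub_apply]
    abel
  rw [hsplit]
  refine Asymptotics.IsLittleO.add ?_
    ((A x).isBigO_comp _ _ |>.trans_isLittleO hg.isLittleO)
  have h1 : (fun y => ‖A y - A x‖) =o[𝓝 x] fun _ => (1 : ℝ) :=
    (Asymptotics.isLittleO_one_iff ℝ).2 (tendsto_iff_norm_sub_tendsto_zero.1 hA)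
  have h2 : (fun y => ‖g y‖) =O[𝓝 x] fun y => ‖y - x‖ := by
    have := hg.isBigO_sub
    simp only [h0, sub_zero] at this
    exact this.norm_norm
  have h3 := h1.mul_isBigO h2
  simp only [one_mul] at h3
  refine (Asymptotics.IsBigO.of_bound 1 (Eventually.of_forall fun y => ?_)).trans_isLittleO
    h3.of_norm_right
  rw [one_mul, Real.norm_of_nonneg (by positivity)]
  exact ContinuousLinearMap.le_opNorm _ _

theorem continuousAt_condM (hf : ∀ i, ContDiff ℝ 1 (f i)) {x : State n} (hx : Regular f x) :
    ContinuousAt (condM f) x := by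
  refine continuous_clm_pi.continuousAt.comp (continuousAt_pi.2 fun i => ?_)
  refine continuousAt_const.sub (tendsto_finsetSum _ fun j _ => ?_)
  exact ContinuousAt.clm_comp (continuousAt_sens hf j.2
    (hx.tailRegular ((Nat.zero_le _).trans_lt j.2))) continuousAt_const

/-- The factorisation `∇f = U M` at regular points. -/
theorem pi_fderiv_eq_upper_comp_condM (hf : ∀ i, ContDiff ℝ 1 (f i)) {x : State n}
    (hx : Regular f x) : ContinuousLinearMap.pi (fun i => fderiv ℝ (f i) x) =
      (upper f 0 x).comp (condM f x) := by
  ext v : 1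
  funext i
  rw [ContinuousLinearMap.comp_apply, upper_apply (Nat.zero_le _)]
  exact fderiv_apply_eq_sum_totalD ((hf i).differentiable one_ne_zero x) (hx i) v

theorem hasFDerivAt_predField (hf : ∀ i, ContDiff ℝ 1 (f i)) {x : State n} (hx : Regular f x)
    (h0 : IsSteady f x) : HasFDerivAt (predField f)
      ((condM f x).inverse.comp ((upper f 0 x).comp (condM f x))) x := by
  rw [show predField f = fun x => (condM f x).inverse fun i => f i x from
    funext predField_eq_inverse, ← pi_fderiv_eq_upper_comp_condM hf hx]
  refine hasFDerivAt_clm_apply_of_eq_zero ?_ ?_ (funext h0)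
  · exact ContinuousAt.comp (g := ContinuousLinearMap.inverse)
      ((isInvertible_of_injective (condM_injective x)).contDiffAt_map_inverse
        (n := 0)).continuousAt (continuousAt_condM hf hx)
  · exact hasFDerivAt_pi.2 fun i => ((hf i).differentiable one_ne_zero x).hasFDerivAt

theorem block_upper_eq_zero (x : State n) {i j : Fin N} (hij : j < i) :
    block (upper f 0 x) i j = 0 := by
  ext v : 1
  change upper f 0 x (Pi.single j v) i = 0
  rw [upper_apply (Nat.zero_le _)]
  refine Finset.sum_eq_zero fun k hk => ?_
  rw [Pi.single_eq_of_ne (hij.trans_le (Finset.mem_Ici.1 hk)).ne', map_zero]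

theorem block_upper {x : State n} {i j : Fin N} (hij : i ≤ j) :
    block (upper f 0 x) i j = totalD f x i j := by
  ext v : 1
  change upper f 0 x (Pi.single j v) i = _
  rw [upper_apply (Nat.zero_le _), Finset.sum_eq_single_of_mem j (Finset.mem_Ici.2 hij),
    Pi.single_eq_same]
  intro k _ hk
  rw [Pi.single_eq_of_ne hk, map_zero]

/-! ### Existence of steady-state maps through a regular steady state -/

/-- The tuple `(x_1, …, x_{i-1}, 0, …, 0)`. -/
def extend {i : Fin N} (s : Slower n i) : State n := fun j => if h : j < i then s ⟨j, h⟩ else 0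

theorem continuous_extend (i : Fin N) : Continuous (extend : Slower n i → State n) := by
  refine continuous_pi fun j => ?_
  by_cases h : j < i
  · simp only [extend, h, dif_pos]; exact continuous_apply _
  · simp only [extend, h, dif_neg, not_false_eq_true]; exact continuous_const

theorem extend_slower (i : Fin N) (x : State n) : extend (slower i x) = headProj n i.val x := by
  funext j
  by_cases h : j < i
  · rw [headProj_of_lt h]; simp [extend, h, slower]
  · rw [headProj_of_le (not_lt.1 h)]; simp [extend, h]

/-- The map x_k^s is the k-th block of the inverse of `tailMap f k` at (x_1, …, x_{k-1}, 0, …, 0).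
The common source W makes the choices consistent: a point of W with f_l = 0 for l ≥ i is recovered
by the inverse of every index k ≥ i, so successive completion reproduces it. -/
theorem exists_steadyMaps_of_homeomorph {W : Set (State n)}
    {e : Fin N → OpenPartialHomeomorph (State n) (State n)} (hs : ∀ i, (e i).source = W)
    (he : ∀ i : Fin N, 0 < i.val → ⇑(e i) = tailMap f i.val) {xs : State n} (hxs : xs ∈ W)
    (h0 : IsSteady f xs) : ∃ B : SteadyMaps f, B.Through xs := by
  let ξ : ∀ k : Fin N, Slower n k → EuclideanSpace ℝ (Fin (n k)) :=
    fun k s => (e k).symm (extend s) k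
  have hinv : ∀ (k : Fin N) (z : State n), 0 < k.val → z ∈ W →
      (∀ l : Fin N, k.val ≤ l.val → f l z = 0) →
      extend (slower k z) ∈ (e k).target ∧ z = (e k).symm (extend (slower k z)) := by
    intro k z hk hz hfz
    have h1 : e k z = extend (slower k z) := by
      rw [he k hk, tailMap_eq_headProj hfz, extend_slower]
    rw [← h1]
    have hz' : z ∈ (e k).source := by rw [hs]; exact hz
    exact ⟨(e k).map_source hz', ((e k).left_inv hz').symm⟩
  have key : ∀ (i : Fin N) (x : State n), 0 < i.val → extend (slower i x) ∈ (e i).target →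
      fill ξ i.val x ∈ W ∧ ∀ k : Fin N, i.val ≤ k.val → f k (fill ξ i.val x) = 0 := by
    intro i x hi hx
    let z := (e i).symm (extend (slower i x))
    have hz : z ∈ W := by rw [← hs i]; exact (e i).map_target hx
    have h1 : tailMap f i.val z = headProj n i.val x := by
      rw [← he i hi, (e i).right_inv hx, extend_slower]
    have h2 : ∀ k : Fin N, i.val ≤ k.val → f k z = 0 := fun k hk => by
      rw [← tailMap_of_le (f := f) hk z, h1, headProj_of_le hk]
    have h3 : z = fill ξ i.val x := by
      refine eq_fill (fun k hk => ?_) fun k hk => ?_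
      · rw [← tailMap_of_lt (f := f) hk z, h1, headProj_of_lt hk]
      · exact congrFun (hinv k z (hi.trans_le hk) hz fun l hl => h2 l (hk.trans hl)).2 k
    rw [← h3]
    exact ⟨hz, h2⟩
  -- The domain for the slowest system is empty, since D_{x_1} f_1 need not be invertible.
  refine ⟨⟨fun i => {s | 0 < i.val ∧ extend s ∈ (e i).target}, ξ, fun i => ?_, fun i => ?_,
    fun i x hx k hk => ?_, fun i x hx => (key i x hx.1 hx.2).2 i le_rfl⟩, fun i hi => ?_⟩
  · exact isOpen_const.inter ((e i).open_target.preimage (continuous_extend i))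
  · exact (continuous_apply i).comp_continuousOn ((e i).continuousOn_symm.comp
      (continuous_extend i).continuousOn fun s hs => hs.2)
  · obtain ⟨h1, h2⟩ := key i x hx.1 hx.2
    have hk : i.val ≤ k.val := hk
    exact ⟨hx.1.trans_le hk, (hinv k _ (hx.1.trans_le hk) h1 fun l hl => h2 l (hk.trans hl)).1⟩
  · obtain ⟨h1, h2⟩ := hinv i xs hi hxs fun l _ => h0 l
    exact ⟨⟨hi, h1⟩, congrFun h2 i⟩

theorem exists_steadyMaps_through (hf : ∀ i, ContDiff ℝ 1 (f i)) {xs : State n}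
    (hreg : Regular f xs) (h0 : IsSteady f xs) : ∃ B : SteadyMaps f, B.Through xs := by
  have h1 : ∀ i : Fin N, ∃ e : OpenPartialHomeomorph (State n) (State n), xs ∈ e.source ∧
      (0 < i.val → ⇑e = tailMap f i.val) := by
    intro i
    by_cases hi : 0 < i.val
    · have h := hasStrictFDerivAt_tailMap_equiv hf (hreg.tailRegular hi)
      exact ⟨h.toOpenPartialHomeomorph, h.mem_toOpenPartialHomeomorph_source,
        fun _ => h.toOpenPartialHomeomorph_coe⟩
    · exact ⟨OpenPartialHomeomorph.refl _, mem_univ _, fun h => absurd h hi⟩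
  choose e he1 he2 using h1
  have hW : IsOpen (⋂ i, (e i).source) := isOpen_iInter_of_finite fun i => (e i).open_source
  refine exists_steadyMaps_of_homeomorph (W := ⋂ i, (e i).source)
    (e := fun i => (e i).restrOpen _ hW) (fun i => ?_) (fun i hi => ?_) (mem_iInter.2 he1) h0
  · rw [OpenPartialHomeomorph.restrOpen_source]
    exact inter_eq_right.2 (iInter_subset _ i)
  · rw [← he2 i hi]; rfl

/-! ### Positive definite matrices and the contraction inequality -/

theorem exists_pos_forall_le {ι : Type*} [Finite ι] {p : ι → ℝ → Prop}
    (hmono : ∀ i a b, b ≤ a → p i a → p i b) (h : ∀ i, ∃ c > 0, p i c) : ∃ c > 0, ∀ i, p i c := by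
  cases nonempty_fintype ι
  choose c hc hp using h
  rcases isEmpty_or_nonempty ι with hι | hι
  · exact ⟨1, one_pos, fun i => hι.elim i⟩
  · obtain ⟨i₀, hi₀⟩ := Finite.exists_min c
    exact ⟨c i₀, hc i₀, fun i => hmono i _ _ (hi₀ i) (hp i)⟩

theorem exists_pos_forall_ge {ι : Type*} [Finite ι] {p : ι → ℝ → Prop}
    (hmono : ∀ i a b, a ≤ b → p i a → p i b) (h : ∀ i, ∃ c, p i c) : ∃ c > 0, ∀ i, p i c := by
  cases nonempty_fintype ι
  choose c hp using h
  obtain ⟨b, hb⟩ := Finite.bddAbove_range c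
  exact ⟨max b 1, lt_max_of_lt_right one_pos, fun i =>
    hmono i _ _ ((hb (mem_range_self i)).trans (le_max_left _ _)) (hp i)⟩

/-- The constant is the minimum of the quadratic form on the compact unit sphere; in dimension 0 the
sphere is empty and any constant serves. -/
theorem exists_pos_le_inner_of_posDef {d : ℕ} {A : Matrix (Fin d) (Fin d) ℝ} (hA : A.PosDef) :
    ∃ c > 0, ∀ v : EuclideanSpace ℝ (Fin d),
      c * ‖v‖ ^ 2 ≤ inner ℝ v (Matrix.toEuclideanCLM (𝕜 := ℝ) A v) := by
  have hpos : ∀ v : EuclideanSpace ℝ (Fin d), v ≠ 0 →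
      0 < inner ℝ v (Matrix.toEuclideanCLM (𝕜 := ℝ) A v) := by
    intro v hv
    rw [Matrix.inner_toEuclideanCLM]
    have hv' : v.ofLp ≠ 0 := fun h => hv (by ext i; exact congrFun h i)
    simpa using hA.dotProduct_mulVec_pos hv'
  rcases (Metric.sphere (0 : EuclideanSpace ℝ (Fin d)) 1).eq_empty_or_nonempty with he | hne
  · refine ⟨1, one_pos, fun v => ?_⟩
    have : v = 0 := by
      by_contra hv
      have : (‖v‖⁻¹ • v) ∈ Metric.sphere (0 : EuclideanSpace ℝ (Fin d)) 1 := by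
        simp [norm_smul, norm_ne_zero_iff.2 hv]
      simp [he] at this
    simp [this]
  · obtain ⟨w, hw, hmin⟩ := (isCompact_sphere (0 : EuclideanSpace ℝ (Fin d)) 1).exists_isMinOn hne
      (f := fun v => inner ℝ v (Matrix.toEuclideanCLM (𝕜 := ℝ) A v))
      (by fun_prop)
    have hw0 : w ≠ 0 := by
      rintro rfl
      simp at hw
    refine ⟨_, hpos w hw0, fun v => ?_⟩
    rcases eq_or_ne v 0 with rfl | hv
    · simp
    have hv' : ‖v‖ ≠ 0 := norm_ne_zero_iff.2 hv
    have h1 := hmin (show ‖v‖⁻¹ • v ∈ Metric.sphere (0 : EuclideanSpace ℝ (Fin d)) 1 by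
      simp [norm_smul, hv'])
    simp only [mem_ofPred_eq, map_smul, inner_smul_left, inner_smul_right] at h1
    calc _ ≤ _ := mul_le_mul_of_nonneg_right h1 (sq_nonneg ‖v‖)
      _ = _ := by simp; field_simp

theorem inner_toEuclideanCLM_comm {d : ℕ} {A : Matrix (Fin d) (Fin d) ℝ} (hA : A.IsHermitian)
    (v w : EuclideanSpace ℝ (Fin d)) : inner ℝ v (Matrix.toEuclideanCLM (𝕜 := ℝ) A w) =
      inner ℝ w (Matrix.toEuclideanCLM (𝕜 := ℝ) A v) := by
  rw [Matrix.inner_toEuclideanCLM, Matrix.inner_toEuclideanCLM, Matrix.dotProduct_mulVec,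
    ← Matrix.mulVec_transpose, dotProduct_comm]
  have : A.transpose = A := by simpa [Matrix.IsHermitian] using hA
  rw [this]

theorem ContractionLMI.inner_le {i : Fin N} {P Q : Matrix (Fin (n i)) (Fin (n i)) ℝ} {x : State n}
    (h : ContractionLMI f i P Q x) (v : EuclideanSpace ℝ (Fin (n i))) :
    2 * inner ℝ v (Matrix.toEuclideanCLM (𝕜 := ℝ) P (totalD f x i i v)) ≤
      -inner ℝ v (Matrix.toEuclideanCLM (𝕜 := ℝ) Q v) := by
  unfold ContractionLMI at h
  set D := (Matrix.toEuclideanCLM (n := Fin (n i)) (𝕜 := ℝ)).symm (totalD f x i i) with hD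
  have hD' : totalD f x i i = Matrix.toEuclideanCLM (n := Fin (n i)) (𝕜 := ℝ) D := by
    rw [hD]; exact (StarAlgEquiv.apply_symm_apply _ _).symm
  have h1 := h.dotProduct_mulVec_nonneg v.ofLp
  have h2 : Matrix.toEuclideanCLM (𝕜 := ℝ) P (totalD f x i i v) =
      Matrix.toEuclideanCLM (𝕜 := ℝ) (P * D) v := by
    rw [hD', map_mul]; rfl
  rw [h2, Matrix.inner_toEuclideanCLM, Matrix.inner_toEuclideanCLM]
  have h3 : v.ofLp ⬝ᵥ (D.transpose * P.transpose).mulVec v.ofLp =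
      v.ofLp ⬝ᵥ (P * D).mulVec v.ofLp := by
    rw [← Matrix.transpose_mul, Matrix.mulVec_transpose, dotProduct_comm,
      ← Matrix.dotProduct_mulVec]
  simp only [Matrix.sub_mulVec, Matrix.add_mulVec, Matrix.neg_mulVec, dotProduct_sub,
    dotProduct_add, dotProduct_neg, h3, star_trivial] at h1
  linarith

/-! ### Strongly monotone maps -/

section Monotone

variable {E : Type*} [NormedAddCommGroup E] [InnerProductSpace ℝ E]

/-- Mean value inequality for s ↦ ⟨z - w, A h(w + s(z - w))⟩ on [0, 1]. -/
theorem inner_sub_le_of_hasFDerivAt {A : E →L[ℝ] E} {h : E → E} {h' : E → E →L[ℝ] E} {q : ℝ}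
    (hh : ∀ z, HasFDerivAt h (h' z) z) (hq : ∀ z v, inner ℝ v (A (h' z v)) ≤ -q * ‖v‖ ^ 2)
    (z w : E) : inner ℝ (z - w) (A (h z - h w)) ≤ -q * ‖z - w‖ ^ 2 := by
  have hd : ∀ s : ℝ, HasDerivAt (fun s : ℝ => inner ℝ (z - w) (A (h (w + s • (z - w)))))
      (inner ℝ (z - w) (A (h' (w + s • (z - w)) (z - w)))) s := by
    intro s
    have h1 : HasDerivAt (fun s : ℝ => w + s • (z - w)) (z - w) s := by
      simpa using ((hasDerivAt_id s).smul_const (z - w)).const_add w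
    have h2 := A.hasFDerivAt.comp_hasDerivAt s ((hh (w + s • (z - w))).comp_hasDerivAt s h1)
    simpa using (hasDerivAt_const s (z - w)).inner ℝ h2
  have := image_sub_le_mul_sub_of_deriv_le (fun s => (hd s).differentiableAt)
    (fun s => by rw [(hd s).deriv]; exact hq _ _) (zero_le_one (α := ℝ))
  simpa [inner_sub_right] using this

/-- For small ε the map z ↦ z + ε(g z - y) is a contraction, and its fixed point solves g z = y. -/
theorem exists_eq_of_inner_sub_le [CompleteSpace E] {g : E → E} {q L : ℝ} (hq : 0 < q)
    (hL : ∀ z w, ‖g z - g w‖ ≤ L * ‖z - w‖)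
    (hg : ∀ z w, inner ℝ (z - w) (g z - g w) ≤ -q * ‖z - w‖ ^ 2) (y : E) : ∃ z, g z = y := by
  have hS : 0 < L ^ 2 + q ^ 2 := by positivity
  -- The squared Lipschitz constant is at most 1 - 2εq + ε²L². This ε gives ε²L² ≤ εq, leaving 1 -
  -- εq, and εq ≤ 1 keeps the square root meaningful.
  set ε := q / (L ^ 2 + q ^ 2) with hε
  have hε0 : 0 < ε := div_pos hq hS
  have hεS : ε * L ^ 2 + ε * q ^ 2 = q := by rw [← mul_add, hε, div_mul_cancel₀ _ hS.ne']
  have hεq : ε * q ≤ 1 := by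
    rw [hε, div_mul_eq_mul_div, div_le_one hS]; nlinarith [sq_nonneg L]
  have hεL : ε ^ 2 * L ^ 2 ≤ ε * q := by nlinarith [sq_nonneg q, mul_pos hε0 hε0]
  let T : E → E := fun z => z + ε • (g z - y)
  have hT : ∀ z w, ‖T z - T w‖ ≤ Real.sqrt (1 - ε * q) * ‖z - w‖ := by
    intro z w
    have h1 : T z - T w = (z - w) + ε • (g z - g w) := by
      simp only [T, smul_sub]; abel
    refine le_of_sq_le_sq ?_ (by positivity)
    rw [mul_pow, Real.sq_sqrt (by linarith), h1, norm_add_sq_real, inner_smul_right, norm_smul,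
      Real.norm_of_nonneg hε0.le, mul_pow]
    have h2 := mul_le_mul_of_nonneg_left (hg z w) hε0.le
    have h3 : ‖g z - g w‖ ^ 2 ≤ L ^ 2 * ‖z - w‖ ^ 2 := by
      rw [← mul_pow]; exact pow_le_pow_left₀ (norm_nonneg _) (hL z w) 2
    have h4 := mul_le_mul_of_nonneg_left h3 (sq_nonneg ε)
    have h5 := mul_le_mul_of_nonneg_right hεL (sq_nonneg ‖z - w‖)
    nlinarith
  have hc : ContractingWith (Real.sqrt (1 - ε * q)).toNNReal T := by
    refine ⟨?_, LipschitzWith.of_dist_le_mul fun z w => ?_⟩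
    · rw [← NNReal.coe_lt_coe, Real.coe_toNNReal _ (Real.sqrt_nonneg _), NNReal.coe_one,
        Real.sqrt_lt' one_pos]
      nlinarith [mul_pos hε0 hq]
    · rw [Real.coe_toNNReal _ (Real.sqrt_nonneg _), dist_eq_norm, dist_eq_norm]
      exact hT z w
  have hfix : T (hc.fixedPoint T) = hc.fixedPoint T := hc.fixedPoint_isFixedPt
  refine ⟨hc.fixedPoint T, ?_⟩
  have h1 : ε • (g (hc.fixedPoint T) - y) = 0 := by simpa [T] using hfix
  exact sub_eq_zero.1 ((smul_eq_zero.1 h1).resolve_left hε0.ne')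

/-- Cauchy–Schwarz gives q‖d‖² ≤ b‖d‖‖r‖. This turns strong monotonicity into uniqueness and
Lipschitz dependence of solutions. -/
theorem norm_le_of_inner_le {A : E →L[ℝ] E} {q b : ℝ} (hq : 0 < q) (hb : ‖A‖ ≤ b) {d r : E}
    (h : inner ℝ d (A r) ≤ -q * ‖d‖ ^ 2) : ‖d‖ ≤ b / q * ‖r‖ := by
  have h1 : -(‖d‖ * (b * ‖r‖)) ≤ inner ℝ d (A r) := by
    refine (neg_le_neg ?_).trans (neg_le_of_abs_le (abs_real_inner_le_norm _ _))
    gcongr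
    exact (A.le_opNorm r).trans (by gcongr)
  rcases eq_or_lt_of_le (norm_nonneg d) with h0 | h0
  · rw [← h0]; exact mul_nonneg (div_nonneg ((norm_nonneg _).trans hb) hq.le) (norm_nonneg _)
  · rw [div_mul_eq_mul_div, le_div_iff₀ hq]
    refine le_of_mul_le_mul_left ?_ h0
    nlinarith

end Monotone

/-! ### Global inverses of the maps `(x_1, …, x_m, f_{m+1}(x), …, f_N(x))` -/

/-- `tailMap f m` has a globally Lipschitz inverse. -/
def HasLipschitzInverse (f : ∀ i : Fin N, State n → EuclideanSpace ℝ (Fin (n i))) (m : ℕ) : Prop :=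
  ∃ (L : NNReal) (Ψ : State n → State n), LipschitzWith L Ψ ∧
    Function.LeftInverse Ψ (tailMap f m) ∧ Function.RightInverse Ψ (tailMap f m)

/-- The columns of the inverse of `M`, obtained from the inverse of `tailMap f (i + 1)`. -/
theorem exists_hasFDerivAt_inverse (hf : ∀ i, ContDiff ℝ 1 (f i))
    (hreg : ∀ x, TailRegular f 0 x) {L : NNReal} {Ψ : State n → State n} {i : Fin N}
    (hL : LipschitzWith L Ψ) (hΨ : Function.RightInverse Ψ (tailMap f (i.val + 1))) (y : State n) :
    ∃ Ψ' : State n →L[ℝ] State n, HasFDerivAt Ψ Ψ' y ∧ ‖Ψ'‖ ≤ L ∧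
      ∀ v, condM f (Ψ y) (Ψ' (Pi.single i v)) = Pi.single i v ∧
        ∀ l, l ≤ i → fderiv ℝ (f l) (Ψ y) (Ψ' (Pi.single i v)) = totalD f (Ψ y) l i v := by
  have hreg' : TailRegular f (i.val + 1) (Ψ y) := (hreg _).mono (Nat.zero_le _)
  have h1 := (hasStrictFDerivAt_tailMap_equiv hf hreg').hasFDerivAt.of_local_left_inverse
    hL.continuous.continuousAt (Eventually.of_forall hΨ)
  refine ⟨_, h1, h1.le_of_lipschitz hL, fun v => ?_⟩
  set w := ((equivOfInjective _ (tailD_injective hf hreg')).symm : State n →L[ℝ] State n)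
    (Pi.single i v) with hw
  have h2 : tailD f (i.val + 1) (Ψ y) w = Pi.single i v :=
    (equivOfInjective _ (tailD_injective hf hreg')).apply_symm_apply _
  have h3 : ∀ k, k ≤ i → w k = (Pi.single i v : State n) k := fun k hk => by
    have hk' : k.val < i.val + 1 := Nat.lt_succ_of_le hk
    rw [← tailD_of_lt (f := f) hk' (Ψ y) w, h2]
  have hd : ∀ k, DifferentiableAt ℝ (f k) (Ψ y) := fun k => (hf k).differentiable one_ne_zero _
  have h4 : condM f (Ψ y) w = Pi.single i v := by
    rw [condM_eq_single hd hreg' (fun k hk => ?_) (fun k hk => ?_), h3 i le_rfl, Pi.single_eq_same]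
    · rw [h3 k hk.le, Pi.single_eq_of_ne hk.ne]
    · rw [← tailD_of_le (show i.val + 1 ≤ k.val from hk), h2, Pi.single_eq_of_ne hk.ne']
  exact ⟨h4, fun l hl => fderiv_apply_eq_totalD (hd l) h4 hl fun _ => hreg _ l (Nat.zero_le _)⟩

theorem update_eq_add_single (y : State n) (i : Fin N) (z w : EuclideanSpace ℝ (Fin (n i))) :
    Function.update y i z = Function.update y i w + Pi.single i (z - w) := by
  funext k
  by_cases hk : k = i
  · subst hk; simp
  · simp [hk]

/-- With Ψ inverse to `tailMap f (i + 1)`, a preimage of y under `tailMap f i` is Ψ of y with block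
i replaced by some z such that h y z = f_i(Ψ(…)) equals y_i. The derivative of h y is D_{x_i} f_i,
so A ∘ h y is Lipschitz and strongly monotone; z = ζ(y) exists, is unique, and is Lipschitz in y. -/
theorem HasLipschitzInverse.pred (hf : ∀ i, ContDiff ℝ 1 (f i)) (hreg : ∀ x, TailRegular f 0 x)
    {i : Fin N} {L₀ : NNReal} (hLf : LipschitzWith L₀ (f i))
    {A : EuclideanSpace ℝ (Fin (n i)) →L[ℝ] EuclideanSpace ℝ (Fin (n i))}
    (hA : Function.Injective A) {q : ℝ} (hq : 0 < q)
    (hD : ∀ x v, inner ℝ v (A (totalD f x i i v)) ≤ -q * ‖v‖ ^ 2)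
    (h : HasLipschitzInverse f (i.val + 1)) : HasLipschitzInverse f i.val := by
  obtain ⟨L, Ψ, hL, hl, hr⟩ := h
  let h : State n → EuclideanSpace ℝ (Fin (n i)) → EuclideanSpace ℝ (Fin (n i)) :=
    fun y z => f i (Ψ (Function.update y i z))
  have hmono : ∀ y z w, inner ℝ (z - w) (A (h y z - h y w)) ≤ -q * ‖z - w‖ ^ 2 := by
    intro y
    refine inner_sub_le_of_hasFDerivAt
      (h' := fun z => totalD f (Ψ (Function.update y i z)) i i) (fun z => ?_) fun z v => hD _ v
    obtain ⟨Ψ', h1, _, h2⟩ := exists_hasFDerivAt_inverse hf hreg hL hr (Function.update y i z)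
    have h3 := (((hf i).differentiable one_ne_zero (Ψ (Function.update y i z))).hasFDerivAt.comp
      _ h1).comp z (hasFDerivAt_update y z)
    refine h3.congr_fderiv ?_
    ext v : 1
    rw [← (h2 v).2 i le_rfl, ← pi_single_id_apply]; rfl
  have hlip : ∀ y y' z z', ‖h y z - h y' z'‖ ≤
      L₀ * (L * ‖Function.update y i z - Function.update y' i z'‖) := fun y y' z z' =>
    (hLf.norm_sub_le _ _).trans (by gcongr; exact hL.norm_sub_le _ _)
  have hlipz : ∀ y z w, ‖h y z - h y w‖ ≤ L₀ * (L * ‖z - w‖) := fun y z w => by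
    refine (hlip y y z w).trans_eq ?_
    rw [update_eq_add_single y i z w, add_sub_cancel_left, Pi.norm_single]
  have hlipy : ∀ y y' z, ‖h y z - h y' z‖ ≤ L₀ * (L * ‖y - y'‖) := fun y y' z => by
    refine (hlip y y' z z).trans ?_
    gcongr
    refine (pi_norm_le_iff_of_nonneg (norm_nonneg _)).2 fun k => ?_
    by_cases hk : k = i
    · subst hk; simp
    · simpa [hk] using norm_le_pi_norm (y - y') k
  have hex : ∀ y : State n, ∃ z, h y z = y i := by
    intro y
    obtain ⟨z, hz⟩ := exists_eq_of_inner_sub_le (g := fun z => A (h y z)) hq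
      (L := ‖A‖ * (L₀ * L)) (fun z w => by
        rw [← map_sub, mul_assoc, mul_assoc]
        exact (A.le_opNorm _).trans (by gcongr; exact hlipz y z w))
      (fun z w => by rw [← map_sub]; exact hmono y z w) (A (y i))
    exact ⟨z, hA hz⟩
  choose ζ hζ using hex
  have hζlip : ∀ y y', ‖ζ y - ζ y'‖ ≤ ‖A‖ / q * ((L₀ * L + 1) * ‖y - y'‖) := by
    intro y y'
    refine (norm_le_of_inner_le hq le_rfl (hmono y' (ζ y) (ζ y'))).trans ?_
    gcongr
    -- The residual of ζ y in the equation for y' splits into the change of h and the change of the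
    -- right-hand side, both Lipschitz in y.
    rw [hζ y', show h y' (ζ y) - y' i = (h y' (ζ y) - h y (ζ y)) + (y - y') i by
      rw [hζ y, Pi.sub_apply]; abel]
    refine (norm_add_le _ _).trans ?_
    have h1 := hlipy y' y (ζ y)
    rw [norm_sub_rev y' y] at h1
    have h2 := norm_le_pi_norm (y - y') i
    linarith
  have huniq : ∀ y z, h y z = y i → z = ζ y := by
    intro y z hz
    have := norm_le_of_inner_le hq le_rfl (hmono y z (ζ y))
    rw [hz, hζ y, sub_self, norm_zero, mul_zero] at this
    exact sub_eq_zero.1 (norm_le_zero_iff.1 this)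
  have hC : 0 ≤ ‖A‖ / q * (L₀ * L + 1) := by positivity
  refine ⟨L * (max 1 (‖A‖ / q * (L₀ * L + 1))).toNNReal,
    fun y => Ψ (Function.update y i (ζ y)), ?_, fun x => ?_, fun y => ?_⟩
  · refine LipschitzWith.of_dist_le_mul fun y y' => ?_
    rw [dist_eq_norm, dist_eq_norm, NNReal.coe_mul, mul_assoc,
      Real.coe_toNNReal _ (hC.trans (le_max_right _ _))]
    refine (hL.norm_sub_le _ _).trans ?_
    gcongr
    refine (pi_norm_le_iff_of_nonneg (by positivity)).2 fun k => ?_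
    by_cases hk : k = i
    · subst hk
      simp only [Pi.sub_apply, Function.update_self]
      refine (hζlip y y').trans ?_
      rw [← mul_assoc]
      gcongr
      exact le_max_right _ _
    · simp only [Pi.sub_apply, ne_eq, hk, not_false_eq_true, Function.update_of_ne]
      refine (norm_le_pi_norm (y - y') k).trans ?_
      exact le_mul_of_one_le_left (norm_nonneg _) (le_max_left _ _)
  · have h1 : Function.update (tailMap f i.val x) i (x i) = tailMap f (i.val + 1) x := by
      funext k
      rcases lt_trichotomy k i with hk | hk | hk
      · have hk' : k.val < i.val := hk
        rw [Function.update_of_ne hk.ne, tailMap_of_lt hk', tailMap_of_lt (by omega)]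
      · subst hk
        rw [Function.update_self, tailMap_of_lt (by omega)]
      · have hk' : i.val < k.val := hk
        rw [Function.update_of_ne hk.ne', tailMap_of_le hk'.le, tailMap_of_le (by omega)]
    have h2 : x i = ζ (tailMap f i.val x) := huniq _ _ (by
      change f i (Ψ (Function.update (tailMap f i.val x) i (x i))) = _
      rw [h1, hl x, tailMap_of_le le_rfl])
    change Ψ (Function.update (tailMap f i.val x) i (ζ (tailMap f i.val x))) = x
    rw [← h2, h1, hl x]
  · have h1 := hr (Function.update y i (ζ y))
    funext k
    have h2 := congrFun h1 k
    rcases lt_trichotomy k i with hk | hk | hk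
    · have hk' : k.val < i.val := hk
      rw [Function.update_of_ne hk.ne, tailMap_of_lt (by omega)] at h2
      rw [tailMap_of_lt hk']
      exact h2
    · subst hk
      rw [tailMap_of_le le_rfl]
      exact hζ y
    · have hk' : i.val < k.val := hk
      rw [Function.update_of_ne hk.ne', tailMap_of_le (by omega)] at h2
      rw [tailMap_of_le hk'.le]
      exact h2

/-- Downward induction from m = N, where `tailMap f N` is the identity. -/
theorem hasLipschitzInverse (hf : ∀ i, ContDiff ℝ 1 (f i)) (hreg : ∀ x, TailRegular f 0 x)
    (hLf : ∀ i, ∃ L, LipschitzWith L (f i))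
    {A : ∀ i, EuclideanSpace ℝ (Fin (n i)) →L[ℝ] EuclideanSpace ℝ (Fin (n i))}
    (hA : ∀ i, Function.Injective (A i)) {q : ℝ} (hq : 0 < q)
    (hD : ∀ x i v, inner ℝ v (A i (totalD f x i i v)) ≤ -q * ‖v‖ ^ 2) {m : ℕ} (hm : m ≤ N) :
    HasLipschitzInverse f m := by
  induction hm using Nat.decreasingInduction with
  | self =>
    have : tailMap f N = id := funext fun x => funext fun k => tailMap_of_lt k.isLt x
    exact ⟨1, id, LipschitzWith.id, by rw [this]; exact fun _ => rfl,
      by rw [this]; exact fun _ => rfl⟩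
  | of_succ m hm ih =>
    exact HasLipschitzInverse.pred (i := ⟨m, hm⟩) hf hreg (hLf _).choose_spec (hA _) hq
      (fun x v => hD x _ v) ih

/-! ### Global solutions under linear growth -/

section GlobalExistence

variable {E : Type*} [NormedAddCommGroup E] [NormedSpace ℝ E]

/-- The radial retraction onto the closed ball of radius `R` about `c`. -/
def radialRetract (c : E) (R : ℝ) (x : E) : E := c + (R / max R ‖x - c‖) • (x - c)

theorem radialRetract_of_le {c x : E} {R : ℝ} (hR : 0 < R) (hx : ‖x - c‖ ≤ R) :
    radialRetract c R x = x := by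
  simp [radialRetract, max_eq_left hx, div_self hR.ne']

theorem norm_radialRetract_sub {c : E} {R : ℝ} (hR : 0 < R) (x : E) :
    ‖radialRetract c R x - c‖ = R / max R ‖x - c‖ * ‖x - c‖ := by
  rw [radialRetract, add_sub_cancel_left, norm_smul,
    Real.norm_of_nonneg (div_nonneg hR.le (le_max_of_le_left hR.le))]

theorem norm_radialRetract_sub_le {c : E} {R : ℝ} (hR : 0 < R) (x : E) :
    ‖radialRetract c R x - c‖ ≤ min R ‖x - c‖ := by
  have hM : 0 < max R ‖x - c‖ := lt_max_of_lt_left hR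
  rw [norm_radialRetract_sub hR, div_mul_eq_mul_div, le_min_iff, div_le_iff₀ hM, div_le_iff₀ hM,
    mul_comm ‖x - c‖]
  exact ⟨by gcongr; exact le_max_right _ _, by gcongr; exact le_max_left _ _⟩

theorem lipschitzWith_radialRetract (c : E) {R : ℝ} (hR : 0 < R) :
    LipschitzWith 2 (radialRetract c R) := by
  refine LipschitzWith.of_dist_le_mul fun x y => ?_
  rw [dist_eq_norm, dist_eq_norm]
  set a := max R ‖x - c‖ with ha
  set b := max R ‖y - c‖ with hb
  have ha0 : 0 < a := lt_max_of_lt_left hR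
  have hb0 : 0 < b := lt_max_of_lt_left hR
  -- Each of the two summands is at most ‖x - y‖, hence the constant 2.
  have hsplit : radialRetract c R x - radialRetract c R y =
      (R / a) • (x - y) + (R / a - R / b) • (y - c) := by
    simp only [radialRetract, ← ha, ← hb]
    module
  have h1 : ‖(R / a) • (x - y)‖ ≤ ‖x - y‖ := by
    rw [norm_smul, Real.norm_of_nonneg (by positivity)]
    exact mul_le_of_le_one_left (norm_nonneg _) ((div_le_one ha0).2 (le_max_left _ _))
  have hab : |b - a| ≤ ‖x - y‖ := by
    rw [ha, hb]
    refine (abs_max_sub_max_le_max _ _ _ _).trans ?_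
    rw [sub_self, abs_zero, max_eq_right (abs_nonneg _), abs_sub_comm]
    simpa using abs_norm_sub_norm_le (x - c) (y - c)
  have h2 : ‖(R / a - R / b) • (y - c)‖ ≤ ‖x - y‖ := by
    have h3 : R / a - R / b = R / a * ((b - a) / b) := by field_simp
    rw [norm_smul, h3, Real.norm_eq_abs, abs_mul, abs_of_nonneg (by positivity : 0 ≤ R / a),
      abs_div, abs_of_pos hb0]
    calc R / a * (|b - a| / b) * ‖y - c‖ ≤ 1 * (|b - a| / b) * b := by
          gcongr
          · exact (div_le_one ha0).2 (le_max_left _ _)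
          · exact le_max_right _ _
      _ = |b - a| := by field_simp
      _ ≤ _ := hab
  rw [hsplit]
  refine (norm_add_le _ _).trans ?_
  push_cast
  linarith

variable [FiniteDimensional ℝ E] {F : E → E} {c : E} {C : ℝ}

/-- Precomposed with the retraction, F is bounded and globally Lipschitz, so Picard–Lindelöf covers
the whole interval. Linear growth and Grönwall keep this solution within radius R, where the
truncated field is F. -/
theorem exists_hasDerivWithinAt_Icc (hF : LocallyLipschitz F) (hC : 0 < C)
    (hFC : ∀ x, ‖F x‖ ≤ C * ‖x - c‖) (t₀ : ℝ) {T : ℝ} (hT : 0 ≤ T) (x₀ : E) :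
    ∃ x : ℝ → E, x t₀ = x₀ ∧
      ∀ t ∈ Icc t₀ (t₀ + T), HasDerivWithinAt x (F (x t)) (Icc t₀ (t₀ + T)) t := by
  have : ProperSpace E := FiniteDimensional.proper_real E
  set R : ℝ := ‖x₀ - c‖ * Real.exp (C * T) + 1 with hRdef
  have hR : 0 < R := by positivity
  obtain ⟨K, hK⟩ := (hF.locallyLipschitzOn (s := Metric.closedBall c
    R)).exists_lipschitzOnWith_of_compact (isCompact_closedBall c R)
  have hmem : ∀ x, radialRetract c R x ∈ Metric.closedBall c R := fun x => by
    rw [mem_closedBall_iff_norm]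
    exact (norm_radialRetract_sub_le hR x).trans (min_le_left _ _)
  have hG : LipschitzWith (K * 2) (fun x => F (radialRetract c R x)) := by
    rw [← lipschitzOnWith_univ]
    exact hK.comp (lipschitzWith_radialRetract c hR).lipschitzOnWith fun x _ => hmem x
  have hGC : ∀ x, ‖F (radialRetract c R x)‖ ≤ C * min R ‖x - c‖ := fun x =>
    (hFC _).trans (by gcongr; exact norm_radialRetract_sub_le hR x)
  have hpl : IsPicardLindelof (fun _ x => F (radialRetract c R x)) (tmin := t₀) (tmax := t₀ + T)
      ⟨t₀, left_mem_Icc.2 (by linarith)⟩ x₀ (C * R * T).toNNReal 0 (C * R).toNNReal (K * 2) := by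
    refine IsPicardLindelof.of_time_independent (fun x _ => ?_) hG.lipschitzOnWith ?_
    · rw [Real.coe_toNNReal _ (by positivity)]
      exact (hGC x).trans (by gcongr; exact min_le_left _ _)
    · rw [Real.coe_toNNReal _ (by positivity), Real.coe_toNNReal _ (by positivity)]
      simp [hT]
  obtain ⟨x, hx0, hx⟩ := hpl.exists_eq_forall_mem_Icc_hasDerivWithinAt₀
  have hx0 : x t₀ = x₀ := hx0
  refine ⟨x, hx0, fun t ht => ?_⟩
  have hgr := norm_le_gronwallBound_of_norm_deriv_right_le (f := fun t => x t - c)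
    (f' := fun t => F (radialRetract c R (x t))) (δ := ‖x₀ - c‖) (K := C) (ε := 0)
    (a := t₀) (b := t₀ + T)
    (fun s hs => (hx s hs).continuousWithinAt.sub continuousWithinAt_const)
    (fun s hs => (hasDerivWithinAt_Ici_of_Icc (hx s (Ico_subset_Icc_self hs)) hs).sub_const c)
    (by rw [hx0]) (fun s _ => by
      rw [add_zero]
      exact (hGC _).trans (by gcongr; exact min_le_right _ _)) t ht
  rw [gronwallBound_ε0] at hgr
  have hle : ‖x t - c‖ ≤ R := by
    refine hgr.trans ?_
    have : Real.exp (C * (t - t₀)) ≤ Real.exp (C * T) := by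
      have := ht.2
      gcongr
      linarith
    have := mul_le_mul_of_nonneg_left this (norm_nonneg (x₀ - c))
    linarith
  have := hx t ht
  rwa [radialRetract_of_le hR hle] at this

/-- A locally Lipschitz vector field of linear growth has solutions for all future times. -/
theorem exists_hasDerivWithinAt_Ici (hF : LocallyLipschitz F) (hC : 0 < C)
    (hFC : ∀ x, ‖F x‖ ≤ C * ‖x - c‖) (t₀ : ℝ) (x₀ : E) :
    ∃ x : ℝ → E, x t₀ = x₀ ∧ ∀ t ∈ Ici t₀, HasDerivWithinAt x (F (x t)) (Ici t₀) t := by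
  have hex : ∀ T : ℝ, ∃ x : ℝ → E, 0 ≤ T → x t₀ = x₀ ∧
      ∀ t ∈ Icc t₀ (t₀ + T), HasDerivWithinAt x (F (x t)) (Icc t₀ (t₀ + T)) t := fun T => by
    by_cases hT : 0 ≤ T
    · obtain ⟨x, hx⟩ := exists_hasDerivWithinAt_Icc hF hC hFC t₀ hT x₀
      exact ⟨x, fun _ => hx⟩
    · exact ⟨fun _ => 0, fun h => absurd h hT⟩
  choose y hy using hex
  have hyeq : ∀ S T : ℝ, 0 ≤ S → S ≤ T → EqOn (y S) (y T) (Icc t₀ (t₀ + S)) := by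
    intro S T hS hST
    have hss : Icc t₀ (t₀ + S) ⊆ Icc t₀ (t₀ + T) := Icc_subset_Icc_right (by linarith)
    refine eqOn_of_hasDerivWithinAt ordConnected_Icc
      (fun t ht => ((hy T (hS.trans hST)).2 t (hss ht)).mono hss) (hy S hS).2
      (fun t _ => hF _) (left_mem_Icc.2 (by linarith)) ?_
    rw [(hy S hS).1, (hy T (hS.trans hST)).1]
  -- At time t the solution with horizon t + 1 is used, so that it is defined on a neighbourhood of
  -- t in `Ici t₀`.
  refine ⟨fun t => y (t - t₀ + 1) t, ?_, fun t ht => ?_⟩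
  · exact (hy _ (by simp)).1
  · have ht : t₀ ≤ t := ht
    have heq : ∀ s ∈ Icc t₀ (t₀ + (t - t₀ + 1)), y (s - t₀ + 1) s = y (t - t₀ + 1) s := by
      intro s hs
      have hs1 := hs.1
      rcases le_total s t with h | h
      · exact hyeq _ _ (by linarith) (by linarith) ⟨hs1, by linarith⟩
      · exact (hyeq _ _ (by linarith) (by linarith) hs).symm
    have htm : t ∈ Icc t₀ (t₀ + (t - t₀ + 1)) := ⟨ht, by linarith⟩
    refine (((hy _ (by linarith)).2 t htm).congr_of_mem heq htm).mono_of_mem_nhdsWithin ?_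
    filter_upwards [self_mem_nhdsWithin, mem_nhdsWithin_of_mem_nhds (Iio_mem_nhds (lt_add_one t))]
      with s hs1 hs2
    exact ⟨hs1, by have : s < t + 1 := hs2; linarith⟩

end GlobalExistence

/-! ### Exponential decay of the right-hand sides -/

/-- After exchanging the sums, s_k has the coefficient (K - 1) ∑_{i<k} K^i = K^k - 1. -/
theorem sum_pow_mul_sum_le {K : ℝ} {s : Fin N → ℝ} (hs : ∀ i, 0 ≤ s i) :
    (K - 1) * ∑ i : Fin N, K ^ i.val * ∑ k, (if i < k then s k else 0) ≤
      ∑ k : Fin N, K ^ k.val * s k := by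
  simp only [Finset.mul_sum]
  rw [Finset.sum_comm]
  refine Finset.sum_le_sum fun k _ => ?_
  have h1 : ∑ i : Fin N, (if i < k then K ^ i.val else 0) = ∑ j ∈ Finset.range k.val, K ^ j := by
    have := Fin.sum_univ_eq_sum_range (fun j => if j < k.val then K ^ j else 0) N
    simp only [← Fin.lt_def] at this
    rw [this, ← Finset.sum_filter]
    refine Finset.sum_congr ?_ fun _ _ => rfl
    ext j
    have := k.isLt
    simp only [Finset.mem_filter, Finset.mem_range]
    omega
  calc ∑ i : Fin N, (K - 1) * (K ^ i.val * (if i < k then s k else 0))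
      = (K - 1) * (∑ i : Fin N, (if i < k then K ^ i.val else 0)) * s k := by
        rw [Finset.mul_sum, Finset.sum_mul]
        exact Finset.sum_congr rfl fun i _ => by split_ifs <;> ring
    _ = (K ^ k.val - 1) * s k := by rw [h1, mul_comm (K - 1), geom_sum_mul]
    _ ≤ _ := by gcongr; exacts [hs k, by linarith]

section Decay

variable {A : ∀ i : Fin N, EuclideanSpace ℝ (Fin (n i)) →L[ℝ] EuclideanSpace ℝ (Fin (n i))}
  {a b q C : ℝ}

/-- With weights that grow fast enough from the slowest to the fastest system, the block diagonal
quadratic form decreases along the block upper triangular matrix `U`. -/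
theorem exists_weight (hq : 0 < q) (hb : ∀ i, ‖A i‖ ≤ b)
    (hD : ∀ x i v, inner ℝ v (A i (totalD f x i i v)) ≤ -q * ‖v‖ ^ 2)
    (hC : ∀ x i k v, i ≤ k → ‖totalD f x i k v‖ ≤ C * ‖v‖) :
    ∃ K : ℝ, 1 ≤ K ∧ ∀ x (u : State n),
      ∑ i : Fin N, K ^ i.val * inner ℝ (u i) (A i (upper f 0 x u i)) ≤
        -(q / 4) * ∑ i : Fin N, K ^ i.val * ‖u i‖ ^ 2 := by
  -- Young's inequality bounds each off-diagonal term by δ‖u_i‖² + D‖u_k‖². At most N such terms per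
  -- row cost at most q/2 of the diagonal decay; K - 1 = 4D/q then makes the D-terms cost at most
  -- q/4.
  set δ := q / (2 * (N + 1)) with hδ
  have hδ0 : 0 < δ := by positivity
  set D := (b * C) ^ 2 / (4 * δ) with hDdef
  have hD0 : 0 ≤ D := by positivity
  have hK : 1 ≤ 1 + 4 * D / q := le_add_of_nonneg_right (by positivity)
  refine ⟨1 + 4 * D / q, hK, fun x u => ?_⟩
  set K := 1 + 4 * D / q with hKdef
  have hrow : ∀ i : Fin N, inner ℝ (u i) (A i (upper f 0 x u i)) ≤
      -(q / 2) * ‖u i‖ ^ 2 + D * ∑ k, (if i < k then ‖u k‖ ^ 2 else 0) := by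
    intro i
    have hI : Finset.Ici i = Finset.univ.filter fun k => i ≤ k := by ext; simp
    rw [upper_apply (Nat.zero_le _), map_sum, inner_sum, hI, Finset.sum_filter]
    have hle : ∀ k, (if i ≤ k then inner ℝ (u i) (A i (totalD f x i k (u k))) else 0) ≤
        (if k = i then -q * ‖u i‖ ^ 2 else 0) + δ * ‖u i‖ ^ 2 +
          D * (if i < k then ‖u k‖ ^ 2 else 0) := by
      intro k
      have hδi : 0 ≤ δ * ‖u i‖ ^ 2 := by positivity
      rcases lt_trichotomy k i with hk | hk | hk
      · simp [hk.not_ge, hk.ne, hk.not_gt, hδi]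
      · subst hk
        simp only [le_refl, if_true, lt_irrefl, if_false, mul_zero, add_zero]
        linarith [hD x k (u k)]
      · simp only [hk.le, if_true, hk.ne', if_false, hk, zero_add]
        have h1 : inner ℝ (u i) (A i (totalD f x i k (u k))) ≤ ‖u i‖ * (b * (C * ‖u k‖)) := by
          refine (real_inner_le_norm _ _).trans ?_
          gcongr
          refine ((A i).le_opNorm _).trans ?_
          gcongr
          · exact (norm_nonneg _).trans (hb i)
          · exact hb i
          · exact hC x i k _ hk.le
        have h2 : (b * C) ^ 2 = D * (4 * δ) := by rw [hDdef, div_mul_cancel₀ _ (by positivity)]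
        refine h1.trans ?_
        have h3 : 0 ≤ (2 * δ * ‖u i‖ - b * C * ‖u k‖) ^ 2 := sq_nonneg _
        have h4 : 0 ≤ 4 * δ * (δ * ‖u i‖ ^ 2 + D * ‖u k‖ ^ 2 - ‖u i‖ * (b * (C * ‖u k‖))) := by
          calc 0 ≤ _ := h3
            _ = 4 * δ * (δ * ‖u i‖ ^ 2 - ‖u i‖ * (b * (C * ‖u k‖))) + (b * C) ^ 2 * ‖u k‖ ^ 2 := by
              ring
            _ = _ := by rw [h2]; ring
        linarith [nonneg_of_mul_nonneg_right h4 (by positivity : 0 < 4 * δ)]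
    refine (Finset.sum_le_sum fun k _ => hle k).trans ?_
    simp only [Finset.sum_add_distrib, Finset.sum_ite_eq', Finset.mem_univ, if_true,
      Finset.sum_const, Finset.card_univ, Fintype.card_fin, nsmul_eq_mul, ← Finset.mul_sum]
    have h5 : (N : ℝ) * δ ≤ q / 2 := by
      rw [hδ, mul_div_assoc', div_le_div_iff₀ (by positivity) (by positivity)]
      nlinarith
    have h6 := mul_le_mul_of_nonneg_right h5 (sq_nonneg ‖u i‖)
    linarith
  set S := ∑ i : Fin N, K ^ i.val * ‖u i‖ ^ 2 with hS
  set X := ∑ i : Fin N, K ^ i.val * ∑ k, (if i < k then ‖u k‖ ^ 2 else 0) with hX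
  have hsum : ∑ i : Fin N, K ^ i.val * inner ℝ (u i) (A i (upper f 0 x u i)) ≤
      -(q / 2) * S + D * X := by
    rw [hS, hX, Finset.mul_sum, Finset.mul_sum, ← Finset.sum_add_distrib]
    refine Finset.sum_le_sum fun i _ => ?_
    have := mul_le_mul_of_nonneg_left (hrow i) (by positivity : 0 ≤ K ^ i.val)
    linarith
  have hX' : (K - 1) * X ≤ S := sum_pow_mul_sum_le fun i => sq_nonneg ‖u i‖
  have hDX : D * X ≤ q / 4 * S := by
    have : q / 4 * ((K - 1) * X) = D * X := by rw [hKdef]; field_simp; ring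
    rw [← this]
    gcongr
  linarith

/-- Chain rule and factorisation: ∇f ẋ = U M ẋ = U f. -/
theorem IsSolution.hasDerivWithinAt_rhs (hf : ∀ i, ContDiff ℝ 1 (f i)) {I : Set ℝ}
    {x : ℝ → State n} (hx : IsSolution f I x) {t : ℝ} (ht : t ∈ I) (hreg : Regular f (x t))
    (k : Fin N) : HasDerivWithinAt (fun s => f k (x s))
      (upper f 0 (x t) (fun i => f i (x t)) k) I t := by
  obtain ⟨x', hx'⟩ := hx
  have hdk : DifferentiableAt ℝ (f k) (x t) := (hf k).differentiable one_ne_zero _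
  rw [← (hx' t ht).2, upper_apply (Nat.zero_le _), ← fderiv_apply_eq_sum_totalD hdk (hreg k)]
  exact hdk.hasFDerivAt.comp_hasDerivWithinAt t (hx' t ht).1

/-- The right-hand sides decay exponentially along all solutions. -/
theorem exists_exp_decay (hf : ∀ i, ContDiff ℝ 1 (f i)) (hreg : ∀ x, Regular f x) (hq : 0 < q)
    (ha : 0 < a) (hA : ∀ i v, a * ‖v‖ ^ 2 ≤ inner ℝ v (A i v))
    (hsymm : ∀ i v w, inner ℝ v (A i w) = inner ℝ w (A i v)) (hb0 : 0 < b) (hb : ∀ i, ‖A i‖ ≤ b)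
    (hD : ∀ x i v, inner ℝ v (A i (totalD f x i i v)) ≤ -q * ‖v‖ ^ 2)
    (hC : ∀ x i k v, i ≤ k → ‖totalD f x i k v‖ ≤ C * ‖v‖) :
    ∃ c > 0, ∃ r > 0, ∀ (I : Set ℝ) (x : ℝ → State n), I.OrdConnected → IsSolution f I x →
      ∀ t₀ ∈ I, ∀ t ∈ I, t₀ ≤ t → ‖fun i => f i (x t)‖ ≤
        c * Real.exp (-r * (t - t₀)) * ‖fun i => f i (x t₀)‖ := by
  obtain ⟨K, hK, hw⟩ := exists_weight hq hb hD hC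
  -- The weighted form V satisfies V ≤ b ∑ K^i ‖u_i‖² and V' ≤ -(q/2) ∑ K^i ‖u_i‖², hence V' ≤ -2rV.
  set r := q / (4 * b) with hr
  have hr0 : 0 < r := by positivity
  set B := b * ∑ i : Fin N, K ^ i.val with hB
  have hB0 : 0 ≤ B := mul_nonneg hb0.le (Finset.sum_nonneg fun i _ => by positivity)
  -- The added 1 keeps the constant positive when N = 0 and B = 0.
  refine ⟨Real.sqrt (B / a + 1), by positivity, r, hr0, fun I x hI hx t₀ ht₀ t ht htt => ?_⟩
  let V : State n → ℝ := fun u => ∑ i : Fin N, K ^ i.val * inner ℝ (u i) (A i (u i))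
  let u : ℝ → State n := fun t i => f i (x t)
  have hAb : ∀ i v, inner ℝ v (A i v) ≤ b * ‖v‖ ^ 2 := fun i v => by
    have h1 := (real_inner_le_norm v (A i v)).trans
      (mul_le_mul_of_nonneg_left ((A i).le_of_opNorm_le (hb i) v) (norm_nonneg v))
    calc _ ≤ _ := h1
      _ = _ := by ring
  have hVS : ∀ v, V v ≤ b * ∑ i : Fin N, K ^ i.val * ‖v i‖ ^ 2 := fun v => by
    rw [Finset.mul_sum]
    refine Finset.sum_le_sum fun i _ => ?_
    have := mul_le_mul_of_nonneg_left (hAb i (v i)) (by positivity : 0 ≤ K ^ i.val)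
    linarith
  have hVB : ∀ v, V v ≤ B * ‖v‖ ^ 2 := fun v => by
    refine (hVS v).trans ?_
    rw [hB, mul_assoc, Finset.sum_mul]
    gcongr with i
    exact norm_le_pi_norm v i
  have hVa : ∀ v i, a * ‖v i‖ ^ 2 ≤ V v := fun v i => by
    have h1 : ∀ j, 0 ≤ inner ℝ (v j) (A j (v j)) := fun j =>
      (by positivity : 0 ≤ a * ‖v j‖ ^ 2).trans (hA j (v j))
    have h2 : K ^ i.val * inner ℝ (v i) (A i (v i)) ≤ V v :=
      Finset.single_le_sum (f := fun i : Fin N => K ^ i.val * inner ℝ (v i) (A i (v i)))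
        (fun j _ => mul_nonneg (by positivity) (h1 j)) (Finset.mem_univ i)
    exact ((hA i (v i)).trans (le_mul_of_one_le_left (h1 i) (one_le_pow₀ hK))).trans h2
  have hVd : ∀ s ∈ I, HasDerivWithinAt (fun s => V (u s)) (2 * ∑ i : Fin N, K ^ i.val *
      inner ℝ (u s i) (A i (upper f 0 (x s) (u s) i))) I s := by
    intro s hs
    have h1 := HasDerivWithinAt.fun_sum (u := Finset.univ) fun i _ =>
      ((hx.hasDerivWithinAt_rhs hf hs (hreg _) i).inner ℝ
        ((A i).hasFDerivAt.comp_hasDerivWithinAt s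
          (hx.hasDerivWithinAt_rhs hf hs (hreg _) i))).const_mul (K ^ i.val)
    refine h1.congr_deriv ?_
    rw [Finset.mul_sum]
    refine Finset.sum_congr rfl fun i _ => ?_
    simp only [u, Function.comp_apply]
    rw [hsymm i (upper f 0 (x s) (fun i => f i (x s)) i)]
    ring
  have hWd : ∀ s ∈ I, HasDerivWithinAt (fun s => Real.exp (2 * r * s) * V (u s))
      (Real.exp (2 * r * s) * (2 * r * V (u s) + 2 * ∑ i : Fin N, K ^ i.val *
        inner ℝ (u s i) (A i (upper f 0 (x s) (u s) i)))) I s := by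
    intro s hs
    have h1 : HasDerivWithinAt (fun s => Real.exp (2 * r * s)) (Real.exp (2 * r * s) * (2 * r)) I s
        := by
      simpa using (((hasDerivAt_id s).const_mul (2 * r)).exp).hasDerivWithinAt
    refine (h1.mul (hVd s hs)).congr_deriv ?_
    ring
  have hanti : AntitoneOn (fun s => Real.exp (2 * r * s) * V (u s)) I := by
    have hat : ∀ s ∈ interior I, HasDerivAt (fun s => Real.exp (2 * r * s) * V (u s)) _ s :=
      fun s hs => (hWd s (interior_subset hs)).hasDerivAt (mem_interior_iff_mem_nhds.1 hs)
    refine antitoneOn_of_deriv_nonpos hI.convex (fun s hs => (hWd s hs).continuousWithinAt)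
      (fun s hs => (hat s hs).differentiableAt.differentiableWithinAt) fun s hs => ?_
    rw [(hat s hs).deriv]
    refine mul_nonpos_of_nonneg_of_nonpos (Real.exp_pos _).le ?_
    have h1 := hw (x s) (u s)
    have h2 := mul_le_mul_of_nonneg_left (hVS (u s)) hr0.le
    have h3 : r * (b * ∑ i : Fin N, K ^ i.val * ‖u s i‖ ^ 2) =
        q / 4 * ∑ i : Fin N, K ^ i.val * ‖u s i‖ ^ 2 := by
      rw [hr]; field_simp
    linarith
  have hVt : V (u t) ≤ Real.exp (-r * (t - t₀)) ^ 2 * V (u t₀) := by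
    have h1 : Real.exp (2 * r * t) * V (u t) ≤ Real.exp (2 * r * t₀) * V (u t₀) :=
      hanti ht₀ ht htt
    have h2 := mul_le_mul_of_nonneg_left h1 (Real.exp_pos (-(2 * r * t))).le
    rw [← mul_assoc, ← mul_assoc, ← Real.exp_add, ← Real.exp_add, neg_add_cancel, Real.exp_zero,
      one_mul] at h2
    refine h2.trans_eq ?_
    rw [← Real.exp_nat_mul]
    congr 2
    push_cast
    ring
  refine (pi_norm_le_iff_of_nonneg (by positivity)).2 fun i => ?_
  refine le_of_sq_le_sq ?_ (by positivity)
  rw [mul_pow, mul_pow, Real.sq_sqrt (by positivity)]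
  have h1 : a * ‖u t i‖ ^ 2 ≤ Real.exp (-r * (t - t₀)) ^ 2 * (B * ‖u t₀‖ ^ 2) :=
    ((hVa (u t) i).trans hVt).trans (by gcongr; exact hVB _)
  have h2 : ‖u t i‖ ^ 2 ≤ B / a * Real.exp (-r * (t - t₀)) ^ 2 * ‖u t₀‖ ^ 2 := by
    rw [div_mul_eq_mul_div, div_mul_eq_mul_div, le_div_iff₀ ha]
    linarith
  refine h2.trans ?_
  gcongr
  linarith

end Decay

/-! ### Global exponential stability -/

/-- Uniform bounds on the columns of `M⁻¹` and of the block upper triangular matrix `U`. -/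
theorem exists_column_bound (hf : ∀ i, ContDiff ℝ 1 (f i)) (hreg : ∀ x, TailRegular f 0 x)
    {L₀ : NNReal} (hLf : ∀ i, LipschitzWith L₀ (f i))
    (hinv : ∀ m ≤ N, HasLipschitzInverse f m) :
    ∃ C > 0, ∀ i, ∀ x v, (∃ w, condM f x w = Pi.single i v ∧ ‖w‖ ≤ C * ‖v‖) ∧
      ∀ l, l ≤ i → ‖totalD f x l i v‖ ≤ C * ‖v‖ := by
  refine exists_pos_forall_ge (fun i a b hab h x v => ?_) fun i => ?_
  · obtain ⟨⟨w, hw, hwn⟩, hl⟩ := h x v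
    have hab' : a * ‖v‖ ≤ b * ‖v‖ := by gcongr
    exact ⟨⟨w, hw, hwn.trans hab'⟩, fun l hli => (hl l hli).trans hab'⟩
  · obtain ⟨L, Ψ, hL, hl, hr⟩ := hinv (i.val + 1) i.isLt
    refine ⟨max L (L₀ * L), fun x v => ?_⟩
    obtain ⟨Ψ', -, h1, h2⟩ := exists_hasFDerivAt_inverse hf hreg hL hr (tailMap f (i.val + 1) x)
    rw [hl x] at h2
    have hw : ‖Ψ' (Pi.single i v)‖ ≤ L * ‖v‖ := by
      refine (Ψ'.le_opNorm _).trans ?_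
      rw [Pi.norm_single]
      gcongr
    refine ⟨⟨_, (h2 v).1, hw.trans (by gcongr; exact le_max_left _ _)⟩, fun l hli => ?_⟩
    rw [← (h2 v).2 l hli]
    calc _ ≤ ‖fderiv ℝ (f l) x‖ * ‖Ψ' (Pi.single i v)‖ := ContinuousLinearMap.le_opNorm _ _
      _ ≤ L₀ * (L * ‖v‖) := by gcongr; exact norm_fderiv_le_of_lipschitz ℝ (hLf l)
      _ = L₀ * L * ‖v‖ := by ring
      _ ≤ _ := by gcongr; exact le_max_right _ _

/-- F = M⁻¹ f is the sum over i of the vectors w_i whose image under M is f_i placed in block i. -/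
theorem norm_predField_le {C : ℝ} {x : State n}
    (hC : ∀ i v, ∃ w, condM f x w = Pi.single i v ∧ ‖w‖ ≤ C * ‖v‖) :
    ‖predField f x‖ ≤ ∑ i, C * ‖f i x‖ := by
  choose w hw hwn using fun i => hC i (f i x)
  have : predField f x = ∑ i, w i := by
    refine ((condM_eq_iff f x _).1 ?_).symm
    rw [map_sum]
    simp only [hw]
    exact Finset.univ_sum_single fun i => f i x
  rw [this]
  exact (norm_sum_le _ _).trans (Finset.sum_le_sum fun i _ => hwn i)

/-- The map f = `tailMap f 0` is Lipschitz with a Lipschitz inverse Ψ, so Ψ 0 is its only zero and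
the decay of ‖f(x)‖ is equivalent to that of ‖x - Ψ 0‖. -/
theorem exists_steady_isGloballyExpStable (hf : ∀ i, ContDiff ℝ 1 (f i))
    (hF : LocallyLipschitzOn {x | Regular f x} (predField f))
    (hLf : ∀ i, ∃ L, LipschitzWith L (f i)) {P Q : ∀ i : Fin N, Matrix (Fin (n i)) (Fin (n i)) ℝ}
    (hP : ∀ i, (P i).PosDef) (hQ : ∀ i, (Q i).PosDef)
    (hPQ : ∀ (x : State n) (i : Fin N), ContractionLMI f i (P i) (Q i) x) :
    ∃ xs : State n, IsSteady f xs ∧ (∀ y, IsSteady f y → y = xs) ∧ IsGloballyExpStable f xs := by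
  let A : ∀ i, EuclideanSpace ℝ (Fin (n i)) →L[ℝ] EuclideanSpace ℝ (Fin (n i)) :=
    fun i => Matrix.toEuclideanCLM (n := Fin (n i)) (𝕜 := ℝ) (P i)
  obtain ⟨a, ha, hA⟩ := exists_pos_forall_le (p := fun i c => ∀ v : EuclideanSpace ℝ (Fin (n i)),
    c * ‖v‖ ^ 2 ≤ inner ℝ v (A i v)) (fun i c d hdc h v => le_trans (by gcongr) (h v))
    fun i => exists_pos_le_inner_of_posDef (hP i)
  obtain ⟨b, hb0, hb⟩ := exists_pos_forall_ge (p := fun i c => ‖A i‖ ≤ c)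
    (fun i c d hcd h => h.trans hcd) fun i => ⟨_, le_rfl⟩
  obtain ⟨q, hq, hD⟩ := exists_pos_forall_le (p := fun i c => ∀ x (v : EuclideanSpace ℝ (Fin (n i))),
    inner ℝ v (A i (totalD f x i i v)) ≤ -c * ‖v‖ ^ 2)
    (fun i c d hdc h x v => (h x v).trans (by gcongr)) fun i => by
      obtain ⟨c, hc, h⟩ := exists_pos_le_inner_of_posDef (hQ i)
      -- The inequality bounds twice the form of P_i D_{x_i} f_i, hence the factor 1/2.
      refine ⟨c / 2, half_pos hc, fun x v => ?_⟩
      have h1 := (hPQ x i).inner_le v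
      have h2 := h v
      simp only [A]
      linarith
  have hD : ∀ x i v, inner ℝ v (A i (totalD f x i i v)) ≤ -q * ‖v‖ ^ 2 := fun x i v => hD i x v
  have hzero : ∀ {c : ℝ} {d : ℕ} {v : EuclideanSpace ℝ (Fin d)}, 0 < c → c * ‖v‖ ^ 2 ≤ 0 → v = 0 :=
    fun {c d v} hc h => norm_eq_zero.1 (pow_eq_zero_iff two_ne_zero |>.1
      (le_antisymm (nonpos_of_mul_nonpos_right h hc) (sq_nonneg _)))
  have hAinj : ∀ i, Function.Injective (A i) := fun i =>
    (injective_iff_map_eq_zero _).2 fun v hv => hzero ha (by simpa [hv] using hA i v)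
  -- Contraction makes every diagonal block injective, including that of the slowest system, so
  -- every point is regular.
  have htail : ∀ x, TailRegular f 0 x := fun x k _ =>
    isInvertible_of_injective ((injective_iff_map_eq_zero _).2 fun v hv =>
      hzero hq (by simpa [hv] using hD x k v))
  have hreg : ∀ x, Regular f x := fun x => (htail x).mono (Nat.zero_le 1)
  have hinv : ∀ m ≤ N, HasLipschitzInverse f m := fun m hm =>
    hasLipschitzInverse hf htail hLf hAinj hq hD hm
  obtain ⟨L₀, hL₀, hLf⟩ := exists_pos_forall_ge (p := fun i c => LipschitzWith c.toNNReal (f i))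
    (fun i c d hcd h => h.weaken (Real.toNNReal_mono hcd)) fun i => by
      obtain ⟨L, hL⟩ := hLf i
      exact ⟨L, by simpa using hL⟩
  obtain ⟨C, hC0, hC⟩ := exists_column_bound hf htail hLf hinv
  obtain ⟨L, Ψ, hL, hl, hr⟩ := hinv 0 (Nat.zero_le _)
  have htm : ∀ x, tailMap f 0 x = fun i => f i x := fun x =>
    funext fun i => tailMap_of_le (Nat.zero_le _) x
  have hsteady : IsSteady f (Ψ 0) := fun i => by
    have := congrFun (hr 0) i
    rwa [htm] at this
  have herr : ∀ x, ‖x - Ψ 0‖ ≤ L * ‖fun i => f i x‖ := fun x => by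
    have := hL.norm_sub_le (tailMap f 0 x) 0
    rwa [hl x, sub_zero, htm] at this
  have hfi : ∀ x i, ‖f i x‖ ≤ L₀ * ‖x - Ψ 0‖ := fun x i => by
    have := (hLf i).norm_sub_le x (Ψ 0)
    rwa [hsteady i, sub_zero, Real.coe_toNNReal _ hL₀.le] at this
  have hfx : ∀ x, ‖fun i => f i x‖ ≤ L₀ * ‖x - Ψ 0‖ := fun x =>
    (pi_norm_le_iff_of_nonneg (by positivity)).2 (hfi x)
  refine ⟨Ψ 0, hsteady, fun y hy => ?_, fun t₀ x₀ => ?_, ?_⟩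
  · have := hl y
    rwa [htm, show (fun i => f i y) = 0 from funext hy, eq_comm] at this
  · have hFl : LocallyLipschitz (predField f) := by
      rw [← locallyLipschitzOn_univ]
      rwa [show {x | Regular f x} = univ from eq_univ_of_forall hreg] at hF
    have hgrowth : ∀ x, ‖predField f x‖ ≤ (N * (C * L₀) + 1) * ‖x - Ψ 0‖ := fun x => by
      refine (norm_predField_le fun i v => (hC i x v).1).trans ?_
      calc ∑ i, C * ‖f i x‖ ≤ ∑ _i : Fin N, C * (L₀ * ‖x - Ψ 0‖) := by
            gcongr with i
            exact hfi x i
        _ = N * (C * L₀) * ‖x - Ψ 0‖ := by simp; ring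
        _ ≤ _ := by gcongr; linarith
    obtain ⟨x, hx0, hx⟩ := exists_hasDerivWithinAt_Ici hFl (by positivity) hgrowth t₀ x₀
    exact ⟨x, hx0, isSolution_iff.2 hx⟩
  · obtain ⟨c, hc, r, hr0, hdecay⟩ := exists_exp_decay hf hreg hq ha hA
      (fun i => inner_toEuclideanCLM_comm (hP i).isHermitian) hb0 hb hD
      fun x i k v hik => (hC k x v).2 i hik
    -- L + 1 in place of L because L may be 0.
    refine ⟨(L + 1) * c * L₀, by positivity, r, hr0, fun t₀ I x hI ht₀ hIc hx t ht => ?_⟩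
    calc ‖x t - Ψ 0‖ ≤ L * ‖fun i => f i (x t)‖ := herr _
      _ ≤ (L + 1) * (c * Real.exp (-r * (t - t₀)) * (L₀ * ‖x t₀ - Ψ 0‖)) := by
        gcongr
        · linarith
        · refine (hdecay I x hI hx t₀ ht₀ t ht (hIc ht)).trans ?_
          gcongr
          exact hfx _
      _ = _ := by ring

/-! ### The three parts of the theorem -/

theorem SteadyMaps.tracks_driven (hf : ∀ i, ContDiff ℝ 1 (f i)) (B : SteadyMaps f) {p : Fin N}
    {t₀ : ℝ} {I : Set ℝ} {x : ℝ → State n} (hI : I.OrdConnected) (ht₀ : t₀ ∈ I)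
    (hdom : ∀ t ∈ I, slower p (x t) ∈ B.dom p)
    (hreg : ∀ t ∈ I, ∀ i, p ≤ i → 0 < i.val →
      (totalD f (fill B.map p.val (x t)) i i).IsInvertible) :
    ((∀ j, j < p → DifferentiableOn ℝ (fun t => x t j) I) →
      IsSolutionFrom f p I (fun t => fill B.map p.val (x t)) ∧
      ∀ t ∈ I, B.Tracks p (fill B.map p.val (x t))) ∧
    (IsSolutionFrom f p I x → B.Tracks p (x t₀) → ∀ t ∈ I, B.Tracks p (x t)) := by
  have htail : ∀ t ∈ I, TailRegular f (max p.val 1) (fill B.map p.val (x t)) := fun t ht k hk =>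
    hreg t ht k ((le_max_left p.val 1).trans hk) ((le_max_right p.val 1).trans hk)
  refine ⟨fun hd => ⟨B.isSolutionFrom_fill hf hdom htail hd, fun t _ => B.tracks_fill p _⟩,
    fun hsol h0 => B.tracks_of_isSolutionFrom hf hI hdom (fun t ht h => ?_) hsol ht₀ h0⟩
  have := htail t ht
  rwa [B.tracks_iff.1 h] at this

theorem SteadyMaps.tracks_solution (hf : ∀ i, ContDiff ℝ 1 (f i)) (B : SteadyMaps f) {p : Fin N}
    {t₀ : ℝ} {I : Set ℝ} {x : ℝ → State n} (hI : I.OrdConnected) (ht₀ : t₀ ∈ I)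
    (hsol : IsSolution f I x) (hreg : ∀ t ∈ I, Regular f (x t))
    (hdom : ∀ t ∈ I, slower p (x t) ∈ B.dom p) (h0 : B.Tracks p (x t₀)) :
    ∀ t ∈ I, B.Tracks p (x t) :=
  B.tracks_of_isSolutionFrom hf hI hdom
    (fun t ht _ => (hreg t ht).tailRegular (lt_max_of_lt_right one_pos))
    (hsol.isSolutionFrom p) ht₀ h0

theorem SteadyMaps.exists_tracks_solution (hf : ∀ i, ContDiff ℝ 1 (f i))
    (hF : LocallyLipschitzOn {x | Regular f x} (predField f)) (B : SteadyMaps f) {p : Fin N}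
    (t₀ : ℝ) {x₀ : State n} (hdom : slower p x₀ ∈ B.dom p) (h0 : B.Tracks p x₀)
    (hreg : Regular f x₀) :
    ∃ ε > 0, ∃ x : ℝ → State n, x t₀ = x₀ ∧ IsSolution f (Ioo (t₀ - ε) (t₀ + ε)) x ∧
      ∀ t ∈ Ioo (t₀ - ε) (t₀ + ε), slower p (x t) ∈ B.dom p ∧ B.Tracks p (x t) := by
  obtain ⟨ε, hε, x, hx0, hsol, hmem⟩ := exists_isSolution_Ioo hf hF hreg t₀
    (inter_mem ((isOpen_setOf_regular hf).mem_nhds hreg) (B.eventually_slower_mem hdom))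
  exact ⟨ε, hε, x, hx0, hsol, fun t ht => ⟨(hmem t ht).2,
    B.tracks_solution hf ordConnected_Ioo ⟨by linarith, by linarith⟩ hsol
      (fun s hs => (hmem s hs).1) (fun s hs => (hmem s hs).2) (hx0.symm ▸ h0) t ht⟩⟩

/-- The similarity is T = M(x^s): conjugating M⁻¹ U M by it leaves U. -/
theorem exists_similar_upper (hf : ∀ i, ContDiff ℝ 1 (f i)) {xs : State n} (h0 : IsSteady f xs)
    (hreg : Regular f xs) : ∃ J : State n →L[ℝ] State n, HasFDerivAt (predField f) J xs ∧
      ∃ (T : State n ≃L[ℝ] State n) (K : State n →L[ℝ] State n),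
        K = ((T : State n →L[ℝ] State n).comp J).comp (T.symm : State n →L[ℝ] State n) ∧
        (∀ i j, j < i → block K i j = 0) ∧
        ∀ B : SteadyMaps f, B.Through xs → ∀ i,
          DifferentiableAt ℝ (fun z => reduced f B i (Function.update xs i z)) (xs i) ∧
          block K i i = partialD (reduced f B i) i xs := by
  refine ⟨_, hasFDerivAt_predField hf hreg h0, equivOfInjective _ (condM_injective (f := f) xs),
    upper f 0 xs, ?_, fun i j hij => block_upper_eq_zero xs hij, fun B hB i =>
      ⟨(hasFDerivAt_reduced hf hB hreg i).differentiableAt, ?_⟩⟩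
  · ext v : 1
    have h1 := (isInvertible_of_injective (condM_injective (f := f) xs)).self_apply_inverse
    have h2 := (equivOfInjective _ (condM_injective (f := f) xs)).apply_symm_apply v
    change _ = condM f xs ((condM f xs).inverse (upper f 0 xs (condM f xs
      ((equivOfInjective _ (condM_injective (f := f) xs)).symm v))))
    rw [h1]
    exact congrArg (upper f 0 xs) h2.symm
  · rw [block_upper le_rfl]
    exact (hasFDerivAt_reduced hf hB hreg i).fderiv.symm

end PredSens

end

theorem mainTheorem1 {N : ℕ} {n : Fin N → ℕ}
    (f : ∀ i : Fin N, State n → EuclideanSpace ℝ (Fin (n i)))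
    (hf : ∀ i, ContDiff ℝ 1 (f i))
    (hF : LocallyLipschitzOn {x | Regular f x} (predField f)) :
    -- (1) tracking of the steady-state maps by the systems `i ≥ p`
    (∀ (B : SteadyMaps f) (p : Fin N) (t₀ : ℝ),
      -- the systems `i ≥ p`, driven by arbitrary signals `x_j`, `j < p`
      (∀ (I : Set ℝ) (x : ℝ → State n), I.OrdConnected → t₀ ∈ I →
        (∀ t ∈ I, slower p (x t) ∈ B.dom p) →
        (∀ t ∈ I, ∀ i, p ≤ i → 0 < i.val → (totalD f (fill B.map p.val (x t)) i i).IsInvertible) →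
        ((∀ j, j < p → DifferentiableOn ℝ (fun t => x t j) I) →
          IsSolutionFrom f p I (fun t => fill B.map p.val (x t)) ∧
          ∀ t ∈ I, B.Tracks p (fill B.map p.val (x t))) ∧
        (IsSolutionFrom f p I x → B.Tracks p (x t₀) → ∀ t ∈ I, B.Tracks p (x t))) ∧
      -- the whole interconnected system
      (∀ x₀ : State n, slower p x₀ ∈ B.dom p → B.Tracks p x₀ → Regular f x₀ →
        (∃ ε > 0, ∃ x : ℝ → State n, x t₀ = x₀ ∧ IsSolution f (Ioo (t₀ - ε) (t₀ + ε)) x ∧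
          ∀ t ∈ Ioo (t₀ - ε) (t₀ + ε), slower p (x t) ∈ B.dom p ∧ B.Tracks p (x t)) ∧
        (∀ (I : Set ℝ) (x : ℝ → State n), I.OrdConnected → t₀ ∈ I → x t₀ = x₀ →
          IsSolution f I x → (∀ t ∈ I, Regular f (x t)) →
          (∀ y : ℝ → State n, y t₀ = x₀ → IsSolution f I y → EqOn y x I) ∧
          ((∀ t ∈ I, slower p (x t) ∈ B.dom p) → ∀ t ∈ I, B.Tracks p (x t))))) ∧
    -- (2) the Jacobian at a steady state
    (∀ xs : State n, IsSteady f xs → Regular f xs →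
      (∃ B : SteadyMaps f, B.Through xs) ∧
      ∃ J : State n →L[ℝ] State n, HasFDerivAt (predField f) J xs ∧
        ∃ (T : State n ≃L[ℝ] State n) (K : State n →L[ℝ] State n),
          K = ((T : State n →L[ℝ] State n).comp J).comp (T.symm : State n →L[ℝ] State n) ∧
          (∀ i j, j < i → block K i j = 0) ∧
          ∀ B : SteadyMaps f, B.Through xs → ∀ i,
            DifferentiableAt ℝ (fun z => reduced f B i (Function.update xs i z)) (xs i) ∧
            block K i i = partialD (reduced f B i) i xs) ∧
    -- (3) global exponential stability
    ((∀ i, ∃ L, LipschitzWith L (f i)) →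
      ∀ P Q : ∀ i : Fin N, Matrix (Fin (n i)) (Fin (n i)) ℝ,
        (∀ i, (P i).PosDef) → (∀ i, (Q i).PosDef) →
        (∀ (x : State n) (i : Fin N), ContractionLMI f i (P i) (Q i) x) →
        ∃ xs : State n, IsSteady f xs ∧ (∀ y, IsSteady f y → y = xs) ∧
          IsGloballyExpStable f xs) := by
  refine ⟨fun B p t₀ => ⟨fun I x hI ht₀ hdom hreg => B.tracks_driven hf hI ht₀ hdom hreg,
    fun x₀ hdom h0 hreg => ⟨B.exists_tracks_solution hf hF t₀ hdom h0 hreg,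
      fun I x hI ht₀ hx0 hsol hregx => ⟨fun y hy0 hy =>
        hsol.eqOn hf hF hI hy hregx ht₀ (hy0.trans hx0.symm), fun hdomx =>
          B.tracks_solution hf hI ht₀ hsol hregx hdomx (hx0.symm ▸ h0)⟩⟩⟩,
    fun xs h0 hreg => ⟨exists_steadyMaps_through hf hreg h0, exists_similar_upper hf h0 hreg⟩,
    fun hL P Q hP hQ hPQ => exists_steady_isGloballyExpStable hf hF hL hP hQ hPQ⟩
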